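/- Let $\Gamma$ be a finite simplicial graph, let $W_\Gamma=\langle V(\Gamma)\mid s^2=1,\ st=ts \text{ for } (s,t)\in E(\Gamma)\rangle$ be its right-angled Coxeter group, with special subgroups $W_T=\langle T\rangle$ for $T\subseteq V(\Gamma)$, and let $\Sigma_\Gamma$ be its Davis complex: the cube complex with vertex set $W_\Gamma$ and one unit cube with vertex set $gW_T$ for each coset of each $W_T$ with $T$ a clique, with the piecewise Euclidean ($\mathrm{CAT}(0)$) length metric. **Hypergraph index.** A *wide subgraph* is an induced subgraph that is maximal among the joins $A\star B$ of two induced subgraphs each containing a pair of distinct non-adjacent vertices. A *strip subgraph* is an induced subgraph of the form $\{a,b\}\star K$, with $a\ne b$ non-adjacent and $K$ a non-empty clique, that is not properly contained in another subgraph of this form or in a wide subgraph. Let $\Lambda_0(\Gamma)$ be the hypergraph on $V(\Gamma)$ whose hyperedges are the vertex sets of the wide and of the strip subgraphs. Given $\Lambda_i(\Gamma)$, call two of its hyperedges $H,H'$ equivalent if there is a finite chain of hyperedges $H=H_0,\dots,H_n=H'$ of $\Lambda_i(\Gamma)$ such that each $H_j\cap H_{j+1}$ contains a pair of distinct non-adjacent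 vertices; the hyperedges of $\Lambda_{i+1}(\Gamma)$ are the unions of the equivalence classes. If $\Gamma$ has a wide subgraph, the *hypergraph index* of $\Gamma$ is the smallest $h\ge 0$ such that some hyperedge of $\Lambda_h(\Gamma)$ contains all vertices of $\Gamma$; it is $\infty$ if there is no such $h$ or if $\Gamma$ has no wide subgraph. **Realization.** $\mathcal R_i(\Gamma)$ is the set of all cosets $gW_H$ with $g\in W_\Gamma$ and $H$ a hyperedge of $\Lambda_i(\Gamma)$ that is not the vertex set of a strip subgraph. Each coset $gW_H$ is regarded as the subspace of $\Sigma_\Gamma$ that is the union of the cubes with all vertices in $gW_H$. **Coarse intersection degree.** Let $X$ be a metric space, write $N_C(A)$ for the $C$-neighbourhood of $A\subseteq X$, and let $\mathcal M$ be a collection of subspaces of $X$. The *coarse intersection degree* of $\mathcal M$ is the smallest integer $d\ge 0$ for which there are collections $\mathcal M=\mathcal M_0,\mathcal M_1,\dots,\mathcal M_d$ of subspaces of $X$, a constant $C>0$, and for each $1\le i\le d$ and $A\in\mathcal M_i$ a collection of elements of $\mathcal M_{i-1}$, called the *pieces* of $A$, such that 1. each $A\in\mathcal M_i$ with $1\le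 i\le d$ contains all its pieces and is contained in the union of the $C$-neighbourhoods of its pieces; 2. any two pieces $A,A'$ of an element $B\in\mathcal M_i$, $1\le i\le d$, are joined by a finite sequence $A=A_1,\dots,A_m=A'$ of pieces of $B$ such that $N_C(A_j)\cap A_{j+1}$ has infinite diameter and is path connected for $1\le j<m$; 3. there is some $A\in\mathcal M_d$ such that $B\subseteq N_C(A)$ for every $B\in\mathcal M$. **Lemma.** If $\Gamma$ has finite hypergraph index $h$, then the coarse intersection degree of $\mathcal R_0(\Gamma)$, regarded as a collection of subspaces of $\Sigma_\Gamma$, is $h$. More generally, for every $0\le i\le h$, the coarse intersection degree of $\mathcal R_i(\Gamma)$ is $h-i$. -/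

import Mathlib

noncomputable section

open Set Metric

namespace RACG

universe u

/-! ### Wide and strip subgraphs, the Lambda hypergraphs, the hypergraph index

Induced subgraphs of a graph are represented by their vertex sets. -/

section Hypergraphs

variable {V : Type u} (Γ : SimpleGraph V)

/-- The vertex set `T` contains a pair of (distinct) non-adjacent vertices. -/
def HasNonadjacentPair (T : Set V) : Prop :=
  ∃ a ∈ T, ∃ b ∈ T, a ≠ b ∧ ¬ Γ.Adj a b

/-- The subgraph induced by `L` is the join of the subgraphs induced by `A` and `B`. -/
def IsJoin (L A B : Set V) : Prop :=
  L = A ∪ B ∧ ∀ a ∈ A, ∀ b ∈ B, Γ.Adj a b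

/-- `L` is a join of two subgraphs each of which contains a pair of non-adjacent vertices. -/
def IsWideJoin (L : Set V) : Prop :=
  ∃ A B : Set V, IsJoin Γ L A B ∧ HasNonadjacentPair Γ A ∧ HasNonadjacentPair Γ B

/-- The set `Ω(Γ)` of wide subgraphs. -/
def wideSubgraphs : Set (Set V) :=
  {L | Maximal (IsWideJoin Γ) L}

/-- `L` is a join of a pair of non-adjacent vertices and a non-empty clique. -/
def IsStripJoin (L : Set V) : Prop :=
  ∃ (a b : V) (K : Set V), a ≠ b ∧ ¬ Γ.Adj a b ∧ K.Nonempty ∧ Γ.IsClique K ∧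
    IsJoin Γ L {a, b} K

/-- The set `Ψ(Γ)` of strip subgraphs: the joins of a non-adjacent pair and a non-empty clique
that are not properly contained in another such join or in a wide subgraph. -/
def stripSubgraphs : Set (Set V) :=
  {L | IsStripJoin Γ L ∧ ∀ L', L' ∈ wideSubgraphs Γ ∨ IsStripJoin Γ L' → L ⊆ L' → L = L'}

/-- The equivalence relation on a set `E` of hyperedges: `H` and `H'` are joined by a finite chain
of hyperedges of `E` in which any two consecutive hyperedges have a pair of non-adjacent vertices
in common. -/
def HyperedgeEquiv (E : Set (Set V)) : Set V → Set V → Prop :=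
  Relation.ReflTransGen fun H H' => H ∈ E ∧ H' ∈ E ∧ HasNonadjacentPair Γ (H ∩ H')

/-- The set of hyperedges of the hypergraph `Λ_i(Γ)`, whose vertex set is `V`. A hyperedge of
`Λ_{i+1}` is the union of an equivalence class of hyperedges of `Λ_i`. -/
def lambdaHyperedges : ℕ → Set (Set V)
  | 0 => wideSubgraphs Γ ∪ stripSubgraphs Γ
  | i + 1 => {F | ∃ H ∈ lambdaHyperedges i,
      F = ⋃₀ {H' ∈ lambdaHyperedges i | HyperedgeEquiv Γ (lambdaHyperedges i) H H'}}

/-- The hypergraph index of `Γ`: the smallest `n` such that some hyperedge of `Λ_n(Γ)` contains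
every vertex; it is `⊤` if there is no such `n` or if `Γ` has no wide subgraph. -/
def hypergraphIndex : ℕ∞ :=
  sInf {m : ℕ∞ | ∃ n : ℕ, m = n ∧ (wideSubgraphs Γ).Nonempty ∧
    ∃ H ∈ lambdaHyperedges Γ n, H = Set.univ}

end Hypergraphs

/-! ### The right-angled Coxeter group -/

section Group

variable {V : Type u} (Γ : SimpleGraph V)

open Classical in
/-- The Coxeter matrix of the right-angled Coxeter group: off the diagonal, the entry is `2` for
adjacent vertices, and `0` (that is, no relation) for non-adjacent ones. -/
def coxeterMatrix : CoxeterMatrix V where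
  M := Matrix.of fun v w => if v = w then 1 else if Γ.Adj v w then 2 else 0
  isSymm := by
    ext v w
    simp only [Matrix.transpose_apply, Matrix.of_apply, Γ.adj_comm v w, eq_comm (a := v)]
  diagonal := by simp
  off_diagonal := by
    intro v w h
    simp only [Matrix.of_apply, if_neg h]
    split_ifs <;> simp

/-- The right-angled Coxeter group `W_Γ`. -/
abbrev W : Type u := (coxeterMatrix Γ).Group

/-- The generator of `W_Γ` corresponding to a vertex. -/
abbrev gen (v : V) : W Γ := (coxeterMatrix Γ).toCoxeterSystem.simple v

/-- The special subgroup `W_T` generated by a set `T` of vertices. -/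
def special (T : Set V) : Subgroup (W Γ) := Subgroup.closure (gen Γ '' T)

open Classical in
theorem isLiftable_sign (s : V) :
    (coxeterMatrix Γ).IsLiftable (fun v => if v = s then (-1 : ℤˣ) else 1) := by
  intro v w
  change _ ^ (if v = w then 1 else if Γ.Adj v w then 2 else 0) = _
  split_ifs <;> simp_all

open Classical in
/-- The homomorphism `W_Γ → {1, -1}` that sends the generator `s` to `-1` and all the other
generators to `1`. -/
def sign (s : V) : W Γ →* ℤˣ :=
  (coxeterMatrix Γ).toCoxeterSystem.lift ⟨_, isLiftable_sign Γ s⟩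

open Classical in
theorem sign_gen (s v : V) : sign Γ s (gen Γ v) = if v = s then -1 else 1 :=
  (coxeterMatrix Γ).toCoxeterSystem.lift_apply_simple (isLiftable_sign Γ s) v

open Classical in
theorem gen_commute {v w : V} (h : Γ.Adj v w) : Commute (gen Γ v) (gen Γ w) := by
  have h2 : (gen Γ v * gen Γ w) ^ 2 = 1 := by
    have := (coxeterMatrix Γ).toCoxeterSystem.simple_mul_simple_pow v w
    have e : (coxeterMatrix Γ) v w = 2 := by
      change (if v = w then 1 else if Γ.Adj v w then 2 else 0) = 2
      simp [h, h.ne]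
    rwa [e] at this
  have h3 : gen Γ v * gen Γ w = (gen Γ v * gen Γ w)⁻¹ := by
    rw [eq_inv_iff_mul_eq_one, ← sq, h2]
  rw [mul_inv_rev, CoxeterSystem.inv_simple, CoxeterSystem.inv_simple] at h3
  exact h3

theorem gen_mem {v : V} {T : Set V} (h : v ∈ T) : gen Γ v ∈ special Γ T :=
  Subgroup.subset_closure ⟨v, h, rfl⟩

theorem special_mono {T U : Set V} (h : T ⊆ U) : special Γ T ≤ special Γ U :=
  Subgroup.closure_mono (Set.image_mono h)

theorem special_induction {T : Set V} {p : W Γ → Prop} (one : p 1)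
    (mul : ∀ (w : W Γ) (r : V), r ∈ T → p w → p (w * gen Γ r)) {w : W Γ} (hw : w ∈ special Γ T) :
    p w := by
  induction hw using Subgroup.closure_induction_right with
  | one => exact one
  | mul_right x hx y hy ih => obtain ⟨r, hr, rfl⟩ := hy; exact mul x r hr ih
  | mul_inv_cancel x hx y hy ih =>
    obtain ⟨r, hr, rfl⟩ := hy
    rw [CoxeterSystem.inv_simple]
    exact mul x r hr ih

theorem sign_eq_one {T : Set V} {s : V} (hs : s ∉ T) {w : W Γ} (hw : w ∈ special Γ T) :
    sign Γ s w = 1 := by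
  refine special_induction Γ (p := fun w => sign Γ s w = 1) (map_one _) (fun w r hr ih => ?_) hw
  have hrs : r ≠ s := by rintro rfl; exact hs hr
  rw [map_mul, ih, sign_gen, if_neg hrs, one_mul]

theorem mem_special_diff {T : Set V} (hT : Γ.IsClique T) {s : V} {w : W Γ}
    (hw : w ∈ special Γ T) (h1 : sign Γ s w = 1) : w ∈ special Γ (T \ {s}) := by
  by_cases hs : s ∈ T
  · have key : w ∈ special Γ (T \ {s}) ∨ w * gen Γ s ∈ special Γ (T \ {s}) := by
      refine special_induction Γ
        (p := fun w => w ∈ special Γ (T \ {s}) ∨ w * gen Γ s ∈ special Γ (T \ {s}))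
        (Or.inl (one_mem _)) (fun w r hr ih => ?_) hw
      by_cases hrs : r = s
      · subst hrs
        rw [mul_assoc, CoxeterSystem.simple_mul_simple_self, mul_one]
        exact ih.symm
      · have hm : gen Γ r ∈ special Γ (T \ {s}) := gen_mem Γ ⟨hr, hrs⟩
        refine ih.imp (fun h => mul_mem h hm) (fun h => ?_)
        rw [mul_assoc, (gen_commute Γ (hT hr hs hrs)).eq, ← mul_assoc]
        exact mul_mem h hm
    refine key.resolve_right fun h => ?_
    have := sign_eq_one Γ (s := s) (by simp) h
    rw [map_mul, h1, sign_gen, if_pos rfl, one_mul] at this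
    exact absurd this (by decide)
  · rwa [Set.sdiff_singleton_eq_self hs]

theorem mem_special_of_sign [Finite V] {T U : Set V} (hT : Γ.IsClique T) {w : W Γ}
    (hw : w ∈ special Γ T) (h1 : ∀ s ∈ T, s ∉ U → sign Γ s w = 1) : w ∈ special Γ U := by
  have key : ∀ F : Set V, F ⊆ T \ U → w ∈ special Γ (T \ F) := by
    intro F
    induction F, Set.toFinite F using Set.Finite.induction_on with
    | empty => simpa using hw
    | @insert a F ha _ ih =>
      intro hF
      have h2 := ih ((Set.subset_insert _ _).trans hF)
      have h3 := mem_special_diff Γ (hT.subset Set.sdiff_subset) (s := a) h2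
        (h1 a (hF (Set.mem_insert _ _)).1 (hF (Set.mem_insert _ _)).2)
      refine special_mono Γ ?_ h3
      rintro x ⟨⟨hx, hx'⟩, hxa⟩
      exact ⟨hx, fun h => h.elim hxa hx'⟩
  refine special_mono Γ ?_ (key _ subset_rfl)
  rintro x ⟨hx, hx'⟩
  by_contra h
  exact hx' ⟨hx, h⟩

end Group

/-! ### The Davis complex

For every coset `g W_T`, with `T` a clique, the Davis complex has a unit cube `[-1/2, 1/2]^T`, with
vertex set `g W_T`. Every such cube is cut by its midcubes into `2 ^ |T|` smaller cubes
`[0, 1/2]^T`, one at each vertex of the cube. The union of the small cubes at a given vertex of the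
complex is a copy of the chamber, the space of all functions `t : V → [0, 1/2]` whose support is a
clique, where `t s` is the distance travelled along the edge labelled `s`. The small cubes at `g`
and `h` in a cube meet where `t` takes the value `1/2` on all the letters of `g⁻¹ h`. So the Davis
complex is the quotient of `W_Γ × chamber` by the relation of `davisSetoid`. -/

section Davis

variable {V : Type u} (Γ : SimpleGraph V)

/-- The chamber of the Davis complex. -/
@[ext]
structure Chamber where
  /-- The coordinates of a point. -/
  coord : V → ℝ
  nonneg : ∀ s, 0 ≤ coord s
  le_half : ∀ s, coord s ≤ 1 / 2
  isClique : Γ.IsClique {s | coord s ≠ 0}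

/-- The support of a point of the chamber. -/
def Chamber.support {Γ : SimpleGraph V} (t : Chamber Γ) : Set V := {s | t.coord s ≠ 0}

/-- The midcubes that contain a point of the chamber. -/
def Chamber.mirrors {Γ : SimpleGraph V} (t : Chamber Γ) : Set V := {s | t.coord s = 1 / 2}

/-- `(g, t)` and `(h, t')` are the same point of the Davis complex if `t = t'` and `g⁻¹ h` lies in
the special subgroup of the letters on which `t` takes the value `1/2`. -/
def davisSetoid : Setoid (W Γ × Chamber Γ) where
  r p q := p.2 = q.2 ∧ p.1⁻¹ * q.1 ∈ special Γ p.2.mirrors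
  iseqv :=
    { refl := fun p => ⟨rfl, by simp [one_mem]⟩
      symm := by
        rintro ⟨g, t⟩ ⟨h, t'⟩ ⟨rfl, h1⟩
        exact ⟨rfl, by simpa using inv_mem h1⟩
      trans := by
        rintro ⟨g, t⟩ ⟨h, t'⟩ ⟨k, t''⟩ ⟨rfl, h1⟩ ⟨rfl, h2⟩
        exact ⟨rfl, by simpa [mul_assoc] using mul_mem h1 h2⟩ }

/-- The Davis complex `Σ_Γ`. -/
def Davis : Type u := Quotient (davisSetoid Γ)

variable {Γ}

/-- The point of the Davis complex at position `t` in the copy at `g` of the chamber. -/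
def Davis.mk (g : W Γ) (t : Chamber Γ) : Davis Γ := Quotient.mk (davisSetoid Γ) (g, t)

theorem Davis.mk_eq_iff {g h : W Γ} {t t' : Chamber Γ} :
    Davis.mk g t = Davis.mk h t' ↔ t = t' ∧ g⁻¹ * h ∈ special Γ t.mirrors :=
  Quotient.eq (r := davisSetoid Γ)

theorem Davis.exists_rep (x : Davis Γ) : ∃ g t, Davis.mk g t = x :=
  Quotient.inductionOn x fun p => ⟨p.1, p.2, rfl⟩

/-- The subcomplex of the Davis complex corresponding to the coset `g W_H`: the union of all the
cubes whose vertices lie in `g W_H`. If `H` is a clique, this is the cube with vertex set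
`g W_H`. -/
def subcomplex (g : W Γ) (H : Set V) : Set (Davis Γ) :=
  {x | ∃ (w : W Γ) (t : Chamber Γ), g⁻¹ * w ∈ special Γ H ∧ t.support ⊆ H ∧ x = Davis.mk w t}

/-- Two points lie in a common (closed) cube of the Davis complex. -/
def SameCube (x y : Davis Γ) : Prop :=
  ∃ (g : W Γ) (T : Set V), Γ.IsClique T ∧ x ∈ subcomplex g T ∧ y ∈ subcomplex g T

/-- The map from the Davis complex to the cube `[-1/2, 1/2]^V` that restricts on each cube
`[-1/2, 1/2]^T` of the Davis complex to an identification with a face of `[-1/2, 1/2]^V`. For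
points `x`, `y` of a common cube, the Euclidean distance of `x` and `y` in that cube is therefore
the Euclidean distance of `fold x` and `fold y`. -/
def fold (x : Davis Γ) : EuclideanSpace ℝ V :=
  Quotient.lift (s := davisSetoid Γ)
    (fun p : W Γ × Chamber Γ =>
      WithLp.toLp 2 fun s => ((sign Γ s p.1 : ℤ) : ℝ) * (1 / 2 - p.2.coord s))
    (by
      rintro ⟨g, t⟩ ⟨h, t'⟩ ⟨h0, h1⟩
      dsimp only at h0 h1
      subst h0
      congr 1
      funext s
      by_cases hs : s ∈ t.mirrors
      · have : t.coord s = 1 / 2 := hs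
        simp [this]
      · have := sign_eq_one Γ hs h1
        rw [map_mul, map_inv, inv_mul_eq_one] at this
        simp only [this])
    x

theorem fold_mk (g : W Γ) (t : Chamber Γ) (s : V) :
    fold (Davis.mk g t) s = ((sign Γ s g : ℤ) : ℝ) * (1 / 2 - t.coord s) := rfl

theorem abs_sign (s : V) (g : W Γ) : |((sign Γ s g : ℤ) : ℝ)| = 1 := by
  rcases Int.units_eq_one_or (sign Γ s g) with h | h <;> simp [h]

theorem SameCube.symm {x y : Davis Γ} (h : SameCube x y) : SameCube y x := by
  obtain ⟨g, T, hT, h1, h2⟩ := h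
  exact ⟨g, T, hT, h2, h1⟩

theorem abs_fold_mk (g : W Γ) (t : Chamber Γ) (s : V) :
    |fold (Davis.mk g t) s| = 1 / 2 - t.coord s := by
  rw [fold_mk, abs_mul, abs_sign, one_mul, abs_of_nonneg (by linarith [t.le_half s])]

variable [Fintype V]

/-- `IsString x y ℓ`: there is a finite string of points from `x` to `y` in which any two
consecutive points lie in a common cube, and the sum of the Euclidean distances of consecutive
points is `ℓ`. -/
inductive IsString : Davis Γ → Davis Γ → ℝ → Prop
  | refl (x : Davis Γ) : IsString x x 0
  | step {x y z : Davis Γ} {l : ℝ} : IsString x y l → SameCube y z →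
      IsString x z (l + dist (fold y) (fold z))

theorem IsString.nonneg {x y : Davis Γ} {l : ℝ} (h : IsString x y l) : 0 ≤ l := by
  induction h with
  | refl => exact le_rfl
  | step _ _ ih => exact add_nonneg ih dist_nonneg

theorem IsString.trans {x y z : Davis Γ} {l m : ℝ} (h : IsString x y l) (h' : IsString y z m) :
    IsString x z (l + m) := by
  induction h' with
  | refl => simpa using h
  | step _ hc ih => rw [← add_assoc]; exact ih.step hc

theorem IsString.single {x y : Davis Γ} (h : SameCube x y) :
    IsString x y (dist (fold x) (fold y)) := by
  simpa using (IsString.refl x).step h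

theorem IsString.symm {x y : Davis Γ} {l : ℝ} (h : IsString x y l) : IsString y x l := by
  induction h with
  | refl => exact .refl _
  | step _ hc ih => rw [add_comm, dist_comm]; exact (IsString.single hc.symm).trans ih

theorem IsString.dist_fold_le {x y : Davis Γ} {l : ℝ} (h : IsString x y l) :
    dist (fold x) (fold y) ≤ l := by
  induction h with
  | refl => simp
  | step _ _ ih => exact (dist_triangle _ _ _).trans (add_le_add_left ih _)

/-- The vertex of the chamber. -/
def Chamber.zero : Chamber Γ where
  coord := 0
  nonneg := by simp
  le_half := by intro; simp
  isClique := by simp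

theorem exists_isString (x y : Davis Γ) : ∃ l, IsString x y l := by
  have h0 : ∀ g : W Γ, ∃ l, IsString (Davis.mk (1 : W Γ) Chamber.zero) (Davis.mk g Chamber.zero) l := by
    intro g
    induction g using (coxeterMatrix Γ).toCoxeterSystem.simple_induction_right with
    | one => exact ⟨0, .refl _⟩
    | mul_simple_right w i ih =>
      obtain ⟨l, hl⟩ := ih
      refine ⟨_, hl.step ⟨w, {i}, by simp, ⟨w, _, by simp [one_mem], ?_, rfl⟩,
        ⟨_, _, ?_, ?_, rfl⟩⟩⟩
      · simp [Chamber.support, Chamber.zero]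
      · rw [inv_mul_cancel_left]; exact gen_mem Γ (by simp)
      · simp [Chamber.support, Chamber.zero]
  have h1 : ∀ x : Davis Γ, ∃ l, IsString (Davis.mk (1 : W Γ) Chamber.zero) x l := by
    intro x
    obtain ⟨g, t, rfl⟩ := x.exists_rep
    obtain ⟨l, hl⟩ := h0 g
    refine ⟨_, hl.step ⟨g, t.support, t.isClique, ⟨g, _, by simp [one_mem], ?_, rfl⟩,
        ⟨g, t, by simp [one_mem], subset_rfl, rfl⟩⟩⟩
    simp [Chamber.support, Chamber.zero]
  obtain ⟨l, hl⟩ := h1 x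
  obtain ⟨m, hm⟩ := h1 y
  exact ⟨_, hl.symm.trans hm⟩

theorem abs_fold_sub_le (x y : Davis Γ) (s : V) : |fold x s - fold y s| ≤ dist (fold x) (fold y) := by
  have := PiLp.norm_apply_le (fold x - fold y) s
  rwa [← dist_eq_norm] at this

theorem SameCube.eq_of_fold {x y : Davis Γ} (h : SameCube x y) (hf : fold x = fold y) :
    x = y := by
  obtain ⟨a, T, hT, ⟨g, t, hg, -, rfl⟩, ⟨w, u, hw, -, rfl⟩⟩ := h
  have htu : t = u := by
    ext s
    have h1 := abs_fold_mk g t s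
    rw [hf, abs_fold_mk] at h1
    linarith
  subst htu
  refine Davis.mk_eq_iff.2 ⟨rfl, mem_special_of_sign Γ hT (w := g⁻¹ * w) ?_ ?_⟩
  · simpa [mul_assoc] using mul_mem (inv_mem hg) hw
  · intro s _ hs
    have h1 : fold (Davis.mk g t) s = fold (Davis.mk w t) s := by rw [hf]
    rw [fold_mk, fold_mk] at h1
    have h2 : (1 / 2 - t.coord s) ≠ 0 := fun h => hs (by change t.coord s = 1 / 2; linarith)
    have h3 := mul_right_cancel₀ h2 h1
    have h4 : sign Γ s g = sign Γ s w := Units.ext (by exact_mod_cast h3)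
    rw [map_mul, map_inv, h4, inv_mul_cancel]

/-- Every point has a neighbourhood in which each cube contains the point. -/
theorem exists_star (x : Davis Γ) : ∃ ε > 0, ∀ y, SameCube x y → dist (fold x) (fold y) < ε →
    ∀ (b : W Γ) (T : Set V), y ∈ subcomplex b T → x ∈ subcomplex b T := by
  obtain ⟨g₀, t, rfl⟩ := x.exists_rep
  obtain ⟨ε, hε, hε1, hεt⟩ : ∃ ε > (0 : ℝ), ε ≤ 1 ∧ ∀ s, t.coord s ≠ 0 → ε ≤ t.coord s := by
    classical
    let F : Finset ℝ := insert 1 ((Finset.univ.filter fun s => t.coord s ≠ 0).image t.coord)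
    have hF : F.Nonempty := ⟨1, by simp [F]⟩
    refine ⟨F.min' hF, ?_, F.min'_le _ (by simp [F]), fun s hs => F.min'_le _ ?_⟩
    · have := F.min'_mem hF
      simp only [F, Finset.mem_insert, Finset.mem_image, Finset.mem_filter, Finset.mem_univ,
        true_and] at this
      rcases this with h | ⟨s, hs, h⟩
      · rw [gt_iff_lt, h]; norm_num
      · rw [gt_iff_lt, ← h]; exact lt_of_le_of_ne (t.nonneg s) (Ne.symm hs)
    · simp only [F, Finset.mem_insert, Finset.mem_image, Finset.mem_filter, Finset.mem_univ,
        true_and]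
      exact Or.inr ⟨s, hs, rfl⟩
  refine ⟨ε, hε, ?_⟩
  rintro y ⟨a, T, hT, ⟨g, t', hg, htT, hx⟩, ⟨w, u, hw, huT, rfl⟩⟩ hd b T' ⟨w', u', hw', hu', hy⟩
  obtain rfl : t = t' := (Davis.mk_eq_iff.1 hx).1
  obtain ⟨rfl, hww'⟩ := Davis.mk_eq_iff.1 hy
  rw [hx] at hd ⊢
  have hc : ∀ s, |fold (Davis.mk g t) s - fold (Davis.mk w u) s| < ε := fun s =>
    (abs_fold_sub_le _ _ s).trans_lt hd
  have hsupp : t.support ⊆ u.support := by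
    intro s hs hs'
    have h1 := abs_fold_mk g t s
    have h2 := abs_fold_mk w u s
    rw [show u.coord s = 0 from hs'] at h2
    have h3 := abs_sub_abs_le_abs_sub (fold (Davis.mk w u) s) (fold (Davis.mk g t) s)
    rw [abs_sub_comm] at h3
    have := hc s
    have := hεt s hs
    linarith
  have hmir : u.mirrors ⊆ T' := fun s hs => hu' (by
    change u.coord s ≠ 0
    rw [show u.coord s = 1 / 2 from hs]; norm_num)
  have hgw : w⁻¹ * g ∈ special Γ u.support := by
    refine mem_special_of_sign Γ hT (w := w⁻¹ * g) ?_ ?_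
    · simpa [mul_assoc] using mul_mem (inv_mem hw) hg
    · intro s _ hs
      have hu0 : u.coord s = 0 := by simpa [Chamber.support] using hs
      have ht0 : t.coord s = 0 := by
        by_contra h
        exact hs (hsupp h)
      have h1 := hc s
      rw [fold_mk, fold_mk, hu0, ht0] at h1
      rw [map_mul, map_inv, inv_mul_eq_one]
      rcases Int.units_eq_one_or (sign Γ s g) with h2 | h2 <;>
        rcases Int.units_eq_one_or (sign Γ s w) with h3 | h3 <;>
        simp only [h2, h3] at h1 ⊢ <;> exfalso <;> norm_num at h1 <;> linarith
  refine ⟨g, t, ?_, hsupp.trans hu', rfl⟩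
  have h1 := mul_mem (mul_mem hw' (inv_mem (special_mono Γ hmir hww'))) (special_mono Γ hu' hgw)
  simpa [mul_assoc] using h1

theorem eq_of_isString (x y : Davis Γ) (h : ∀ ε > 0, ∃ l < ε, IsString x y l) : x = y := by
  obtain ⟨ε, hε, hstar⟩ := exists_star x
  have key : ∀ {x' y : Davis Γ} {l : ℝ}, IsString x' y l → x' = x → l < ε → SameCube x y := by
    intro x' y l hl
    induction hl with
    | refl =>
      intro hx _
      obtain ⟨g, t, hgt⟩ := x.exists_rep
      rw [hx, ← hgt]
      exact ⟨g, t.support, t.isClique, ⟨g, t, by simp [one_mem], subset_rfl, rfl⟩,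
        ⟨g, t, by simp [one_mem], subset_rfl, rfl⟩⟩
    | step hs hc ih =>
      rintro rfl hl
      have hl' := (le_add_of_nonneg_right dist_nonneg).trans_lt hl
      obtain ⟨b, T, hT, h1, h2⟩ := hc
      exact ⟨b, T, hT, hstar _ (ih rfl hl') (hs.dist_fold_le.trans_lt hl') b T h1, h2⟩
  obtain ⟨l, hl, hs⟩ := h ε hε
  refine (key hs rfl hl).eq_of_fold (dist_le_zero.1 (le_of_forall_pos_lt_add fun δ hδ => ?_))
  obtain ⟨l, hl, hs⟩ := h δ hδ
  simpa using hs.dist_fold_le.trans_lt hl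

/-- The distance of two points of the Davis complex is the infimum of the lengths of the strings
from one to the other. This is the piecewise Euclidean (`CAT(0)`) length metric. -/
instance : MetricSpace (Davis Γ) where
  dist x y := sInf {l | IsString x y l}
  dist_self x := le_antisymm (csInf_le ⟨0, fun _ h => IsString.nonneg h⟩ (.refl x))
    (le_csInf ⟨0, .refl x⟩ fun _ h => IsString.nonneg h)
  dist_comm x y := by
    congr 1
    ext l
    exact ⟨IsString.symm, IsString.symm⟩
  dist_triangle x y z := by
    refine le_of_forall_pos_lt_add fun ε hε => ?_
    obtain ⟨l, hl, hl'⟩ := exists_lt_of_csInf_lt (exists_isString x y)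
      (lt_add_of_pos_right (sInf {l | IsString x y l}) (half_pos hε))
    obtain ⟨m, hm, hm'⟩ := exists_lt_of_csInf_lt (exists_isString y z)
      (lt_add_of_pos_right (sInf {l | IsString y z l}) (half_pos hε))
    have := csInf_le (s := {l | IsString x z l}) ⟨0, fun _ h => IsString.nonneg h⟩
      (IsString.trans hl hm)
    linarith
  eq_of_dist_eq_zero := by
    intro x y h
    refine eq_of_isString x y fun ε hε => ?_
    obtain ⟨l, hl, hl'⟩ := exists_lt_of_csInf_lt (exists_isString x y)
      (show sInf {l | IsString x y l} < ε from lt_of_eq_of_lt h hε)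
    exact ⟨l, hl', hl⟩

end Davis

/-! ### The realization -/

/-- The realization `R_i(Γ)`: the subcomplexes of the Davis complex that correspond to the cosets
`g W_H`, for `H` a hyperedge of `Λ_i(Γ)` that is not a strip subgraph. -/
def realization {V : Type u} (Γ : SimpleGraph V) (i : ℕ) : Set (Set (Davis Γ)) :=
  {A | ∃ H ∈ lambdaHyperedges Γ i, H ∉ stripSubgraphs Γ ∧ ∃ g : W Γ, A = subcomplex g H}

end RACG

/-! ### The coarse intersection degree -/

/-- `M 0, M 1, …, M d` is a coarse intersection sequence for the collection `𝓜`, with coarse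
intersection constant `C`, where the collection of pieces of `A ∈ M (i + 1)` is `P i A ⊆ M i`. -/
structure IsCoarseIntersectionSequence {X : Type*} [MetricSpace X] (𝓜 : Set (Set X)) (d : ℕ)
    (M : ℕ → Set (Set X)) (C : ℝ) (P : ℕ → Set X → Set (Set X)) : Prop where
  pos : 0 < C
  zero : M 0 = 𝓜
  pieces_mem : ∀ i < d, ∀ A ∈ M (i + 1), P i A ⊆ M i
  subset_thickening : ∀ i < d, ∀ A ∈ M (i + 1), A ⊆ ⋃ B ∈ P i A, thickening C B
  pieces_subset : ∀ i < d, ∀ A ∈ M (i + 1), (⋃ B ∈ P i A, B) ⊆ A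
  chain : ∀ i < d, ∀ B ∈ M (i + 1), ∀ A ∈ P i B, ∀ A' ∈ P i B,
    ∃ (m : ℕ) (S : ℕ → Set X), S 0 = A ∧ S m = A' ∧ (∀ j ≤ m, S j ∈ P i B) ∧
      ∀ j < m, ediam (thickening C (S j) ∩ S (j + 1)) = ⊤ ∧
        IsPathConnected (thickening C (S j) ∩ S (j + 1))
  top : ∃ A ∈ M d, ∀ B ∈ 𝓜, B ⊆ thickening C A

/-- The coarse intersection degree of `𝓜` is `d`: the number `d` is the smallest length of a
coarse intersection sequence for `𝓜`. -/
def HasCoarseIntersectionDegree {X : Type*} [MetricSpace X] (𝓜 : Set (Set X)) (d : ℕ) : Prop :=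
  IsLeast {n : ℕ | ∃ M C P, IsCoarseIntersectionSequence 𝓜 n M C P} d

end

/-!
The coarse intersection degree of `R_i(Γ)` is `h - i` because a coarse intersection sequence can
be made of the realizations `R_i(Γ), …, R_h(Γ)`, and because no such sequence can grow faster.

*Upper bound.* Let `F` be the union of the class of a hyperedge `H₀` of `Λ_j(Γ)` that is not a
strip. The pieces of `g W_F` are its subcosets of the form `u W_K`, with `K` in the class but not a
strip. Two pieces `u W_K` and `u W_K'` with a non-adjacent pair in `K ∩ K'` are consecutive. In a
chain of hyperedges a strip can be skipped, as its only non-adjacent pair belongs to its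
predecessor (`HyperedgeEquiv.exists_notMem_strip`). A generator `s` that only belongs to a strip
`{a, b} ⋆ K'` commutes with `a` and `b`, so that the parallel cosets `u W_K` and `u s W_K` are
consecutive for each `K` containing `a` and `b` (`reflTransGen_mul`).

That the intersections in question are path connected is shown without the `CAT(0)` inequality.
Killing the generators outside `H` induces a retraction of the Davis complex onto the subcomplex of
`u W_H` that does not increase distances (`retract`). Balls are path connected, since points of a
cube are joined by segments. If two cosets intersect, then the retraction onto one of them preserves
the other one, and pushes a path in a ball around a point of the latter into the former
(`isPathConnected_thickening_inter`). For parallel cosets this is done with the part of the path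
before it crosses the wall between them (`isPathConnected_thickening_inter_mul_gen`).

*Lower bound.* If `W_H` and `k W_{H'} k⁻¹` have infinite intersection, then `H ∩ H'` contains a
non-adjacent pair `a`, `b`, and `k` is in `W_H W_L W_{H'}` for the set `L` of the common neighbours
of `a` and `b` (`exists_nonadjacent_of_infinite`). The vertices of `L` belong to the union of the
class of `H`, since `{a, b}` and a common neighbour are contained in a wide or strip subgraph. So by
induction every member of the `j`-th collection of a coarse intersection sequence for `R_i(Γ)` is
contained in a neighbourhood of a coset `g W_F`, with `F` a hyperedge of `Λ_{i+j}(Γ)`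
(`exists_subset_thickening`). If this coset is coarsely dense, then every vertex outside `F` is
adjacent to all the others (`adj_of_finite`), and such vertices belong to all hyperedges
(`mem_of_forall_adj`). Hence `F` contains all vertices.

Bounded sets meet only finitely many copies of the chamber (`exists_finite_of_dist_lt`); this
translates between the metric of the Davis complex and the group.
-/

noncomputable section

open Set Metric

namespace RACG

/-! ### Special subgroups and walls of the right-angled Coxeter group -/

section Group

variable {V : Type*} (Γ : SimpleGraph V)

theorem isLiftable_of_commute {G : Type*} [Group G] {f : V → G} (hsq : ∀ v, f v * f v = 1)
    (hcomm : ∀ v w, Γ.Adj v w → Commute (f v) (f w)) : (coxeterMatrix Γ).IsLiftable f := by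
  classical
  intro v w
  change _ ^ (if v = w then 1 else if Γ.Adj v w then 2 else 0) = _
  split_ifs with h1 h2
  · subst h1; simp [hsq]
  · rw [(hcomm v w h2).mul_pow, sq, sq, hsq, hsq, one_mul]
  · simp

theorem gen_mul_gen (s : V) : gen Γ s * gen Γ s = 1 :=
  CoxeterSystem.simple_mul_simple_self _ s

theorem gen_inv (s : V) : (gen Γ s)⁻¹ = gen Γ s := CoxeterSystem.inv_simple _ s

open Classical in
/-- The retraction of `W_Γ` onto the special subgroup `W_H` that kills the generators outside
`H`. -/
def restrict (H : Set V) : W Γ →* W Γ :=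
  (coxeterMatrix Γ).toCoxeterSystem.lift ⟨fun v => if v ∈ H then gen Γ v else 1,
    isLiftable_of_commute Γ (fun v => by split_ifs <;> simp) (fun v w h => by
      split_ifs <;> simp [gen_commute Γ h])⟩

open Classical in
theorem restrict_gen (H : Set V) (v : V) :
    restrict Γ H (gen Γ v) = if v ∈ H then gen Γ v else 1 :=
  (coxeterMatrix Γ).toCoxeterSystem.lift_apply_simple _ v

theorem restrict_mem (H : Set V) {T : Set V} {w : W Γ} (hw : w ∈ special Γ T) :
    restrict Γ H w ∈ special Γ (T ∩ H) := by
  refine special_induction Γ (p := fun w => restrict Γ H w ∈ special Γ (T ∩ H)) ?_ ?_ hw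
  · simp [one_mem]
  · intro w r hr ih
    rw [map_mul, restrict_gen]
    split_ifs with h
    · exact mul_mem ih (gen_mem Γ ⟨hr, h⟩)
    · simpa using ih

theorem restrict_eq_self {H : Set V} {w : W Γ} (hw : w ∈ special Γ H) : restrict Γ H w = w := by
  refine special_induction Γ (p := fun w => restrict Γ H w = w) (map_one _) ?_ hw
  intro w r hr ih
  rw [map_mul, restrict_gen, if_pos hr, ih]

theorem special_univ : special Γ univ = ⊤ := by
  rw [special, image_univ]
  exact (coxeterMatrix Γ).toCoxeterSystem.subgroup_closure_range_simple

theorem mem_special_univ (w : W Γ) : w ∈ special Γ univ := by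
  rw [special_univ]; trivial

theorem restrict_mem_special (H : Set V) (w : W Γ) : restrict Γ H w ∈ special Γ H := by
  simpa using restrict_mem Γ H (mem_special_univ Γ w)

theorem mem_special_inter {A B : Set V} {w : W Γ} (hA : w ∈ special Γ A) (hB : w ∈ special Γ B) :
    w ∈ special Γ (A ∩ B) := by
  have := restrict_mem Γ B hA
  rwa [restrict_eq_self Γ hB] at this

theorem sign_restrict_of_mem {H : Set V} {s : V} (hs : s ∈ H) (w : W Γ) :
    sign Γ s (restrict Γ H w) = sign Γ s w := by
  refine special_induction Γ (p := fun w => sign Γ s (restrict Γ H w) = sign Γ s w) (by simp) ?_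
    (mem_special_univ Γ w)
  intro w r _ ih
  rw [map_mul, map_mul, ih, restrict_gen, map_mul]
  split_ifs with h
  · rfl
  · rw [sign_gen, if_neg (by rintro rfl; exact h hs), map_one]

open Classical in
/-- The homomorphism to the infinite dihedral group that sends `a` and `b` to reflections
generating it and the other generators to `1`. -/
def dihedralHom {a b : V} (hab : ¬ Γ.Adj a b) : W Γ →* DihedralGroup 0 :=
  (coxeterMatrix Γ).toCoxeterSystem.lift
    ⟨fun v => if v = a then .sr 0 else if v = b then .sr 1 else 1,
    isLiftable_of_commute Γ (fun v => by split_ifs <;> simp) (fun v w h => by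
      have h' := h.symm
      split_ifs <;> simp_all)⟩

open Classical in
theorem dihedralHom_gen {a b : V} (hab : ¬ Γ.Adj a b) (v : V) :
    dihedralHom Γ hab (gen Γ v) = if v = a then .sr 0 else if v = b then .sr 1 else 1 :=
  (coxeterMatrix Γ).toCoxeterSystem.lift_apply_simple _ v

theorem dihedralHom_pow {a b : V} (hab : ¬ Γ.Adj a b) (hne : a ≠ b) (n : ℕ) :
    dihedralHom Γ hab ((gen Γ a * gen Γ b) ^ n) = .r n := by
  rw [map_pow, map_mul, dihedralHom_gen, dihedralHom_gen, if_pos rfl, if_neg hne.symm, if_pos rfl]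
  simp

theorem injective_pow {a b : V} (hab : ¬ Γ.Adj a b) (hne : a ≠ b) :
    Function.Injective fun n : ℕ => (gen Γ a * gen Γ b) ^ n := by
  intro m n h
  have h2 := congrArg (dihedralHom Γ hab) h
  simp only [dihedralHom_pow Γ hab hne] at h2
  have h3 : ((m : ℤ)) = n := by simpa using h2
  exact_mod_cast h3

theorem finite_special [Finite V] {T : Set V} (hT : Γ.IsClique T) :
    (special Γ T : Set (W Γ)).Finite := by
  refine Set.Finite.of_injOn (f := fun w s => sign Γ s w) (t := univ) (fun _ _ => trivial) ?_
    finite_univ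
  intro w hw w' hw' h
  have h1 : w⁻¹ * w' ∈ special Γ (∅ : Set V) := by
    refine mem_special_of_sign Γ hT (mul_mem (inv_mem hw) hw') fun s _ _ => ?_
    have := congrFun h s
    dsimp only at this
    rw [map_mul, map_inv, this, inv_mul_cancel]
  rw [special, image_empty, Subgroup.closure_empty, Subgroup.mem_bot] at h1
  exact inv_mul_eq_one.1 h1

/-- The centralizer of the generator `s`, in the form of the special subgroup of `s` and its
neighbours. Its left cosets correspond to the walls of the Davis complex of type `s`: the wall of
`w star s` is the one dual to the edge from `w` to `w s`. -/
def star (s : V) : Subgroup (W Γ) := special Γ (insert s (Γ.neighborSet s))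

theorem gen_mem_star (s : V) : gen Γ s ∈ star Γ s := gen_mem Γ (mem_insert _ _)

theorem gen_mem_star_of_adj {s r : V} (h : Γ.Adj s r) : gen Γ r ∈ star Γ s :=
  gen_mem Γ (mem_insert_of_mem _ h)

theorem commute_of_mem_star {s : V} {w : W Γ} (hw : w ∈ star Γ s) : gen Γ s * w = w * gen Γ s := by
  refine special_induction Γ (p := fun w => gen Γ s * w = w * gen Γ s) (by simp) ?_ hw
  rintro w r (rfl | hr) ih
  · rw [← mul_assoc, ih]
  · rw [← mul_assoc, ih, mul_assoc, mul_assoc, (gen_commute Γ hr).eq]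

theorem gen_mul_mem_star_iff {s r : V} (h : gen Γ r ∈ star Γ s) (w : W Γ) :
    gen Γ r * w ∈ star Γ s ↔ w ∈ star Γ s :=
  Subgroup.mul_mem_cancel_left _ h

open Classical in
/-- The permutation of `W_Γ × {1, -1}` by which the generator `r` acts: it multiplies the first
entry by `r` and changes the second one if `r` crosses the wall of `star s`. As the group acts from
the left, the first entry stands for the inverse of the position. -/
def sidePerm (s r : V) : Equiv.Perm (W Γ × ℤˣ) :=
  Function.Involutive.toPerm
    (fun p => (gen Γ r * p.1, if r = s ∧ p.1 ∈ star Γ s then -p.2 else p.2)) (by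
      rintro ⟨w, e⟩
      by_cases hr : r = s
      · subst hr
        by_cases h : w ∈ star Γ r <;>
          simp [gen_mul_mem_star_iff Γ (gen_mem_star Γ r), h]
      · simp [hr])

open Classical in
theorem sidePerm_apply (s r : V) (p : W Γ × ℤˣ) : sidePerm Γ s r p =
    (gen Γ r * p.1, if r = s ∧ p.1 ∈ star Γ s then -p.2 else p.2) := rfl

theorem isLiftable_sidePerm (s : V) : (coxeterMatrix Γ).IsLiftable (sidePerm Γ s) := by
  classical
  refine isLiftable_of_commute Γ (fun v => ?_) (fun v w h => ?_)
  · ext1 p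
    exact Function.Involutive.toPerm_involutive _ p
  · ext1 ⟨x, e⟩
    simp only [Equiv.Perm.mul_apply, sidePerm_apply, ← mul_assoc, (gen_commute Γ h).eq]
    by_cases hv : v = s
    · subst hv
      simp only [h.ne', false_and, if_false]
      exact congrArg _ (if_congr (by rw [gen_mul_mem_star_iff Γ (gen_mem_star_of_adj Γ h)]) rfl rfl)
    · by_cases hw : w = s
      · subst hw
        simp only [hv, false_and, if_false]
        exact congrArg _
          (if_congr (by rw [gen_mul_mem_star_iff Γ (gen_mem_star_of_adj Γ h.symm)]) rfl rfl)
      · simp [hv, hw]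

/-- The side of the wall dual to the edge from `1` to `s` on which `w` lies: `1` for the side of
the identity and `-1` for the other one. -/
def side (s : V) (w : W Γ) : ℤˣ :=
  ((coxeterMatrix Γ).toCoxeterSystem.lift ⟨_, isLiftable_sidePerm Γ s⟩ w⁻¹ (1, 1)).2

@[simp]
theorem side_one (s : V) : side Γ s 1 = 1 := by simp [side]

open Classical in
theorem side_mul_gen (s r : V) (w : W Γ) :
    side Γ s (w * gen Γ r) = if r = s ∧ w ∈ star Γ s then - side Γ s w else side Γ s w := by
  have hfst : ∀ w : W Γ, ((coxeterMatrix Γ).toCoxeterSystem.lift ⟨_, isLiftable_sidePerm Γ s⟩ w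
      (1, 1)).1 = w := by
    intro w
    induction w using (coxeterMatrix Γ).toCoxeterSystem.simple_induction_left with
    | one => simp
    | mul_simple_left w i ih =>
      rw [map_mul, Equiv.Perm.mul_apply, CoxeterSystem.lift_apply_simple]
      rw [sidePerm_apply, ih]
  simp only [side]
  rw [mul_inv_rev, gen_inv, map_mul, Equiv.Perm.mul_apply, CoxeterSystem.lift_apply_simple]
  rw [sidePerm_apply, hfst, inv_mem_iff]

theorem side_gen_mul (s : V) (w : W Γ) : side Γ s (gen Γ s * w) = - side Γ s w := by
  induction w using (coxeterMatrix Γ).toCoxeterSystem.simple_induction_right with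
  | one =>
    have := side_mul_gen Γ s s 1
    rw [if_pos ⟨rfl, one_mem _⟩] at this
    simpa using this
  | mul_simple_right w i ih =>
    change side Γ s (gen Γ s * (w * gen Γ i)) = - side Γ s (w * gen Γ i)
    rw [← mul_assoc, side_mul_gen, side_mul_gen, ih, gen_mul_mem_star_iff Γ (gen_mem_star Γ s)]
    split_ifs <;> rfl

theorem side_mul_of_notMem {s : V} {T : Set V} (hs : s ∉ T) (w : W Γ) {u : W Γ}
    (hu : u ∈ special Γ T) : side Γ s (w * u) = side Γ s w := by
  refine special_induction Γ (p := fun u => side Γ s (w * u) = side Γ s w) (by simp) ?_ hu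
  intro u r hr ih
  rw [← mul_assoc, side_mul_gen, if_neg, ih]
  rintro ⟨rfl, -⟩
  exact hs hr

theorem side_mul_of_notMem_star {s : V} {w u : W Γ} (hw : w ∉ star Γ s) (hu : u ∈ star Γ s) :
    side Γ s (w * u) = side Γ s w := by
  have : w * u ∉ star Γ s ∧ side Γ s (w * u) = side Γ s w := by
    refine special_induction Γ
      (p := fun u => w * u ∉ star Γ s ∧ side Γ s (w * u) = side Γ s w) (by simpa using hw) ?_ hu
    intro u r hr ih
    rw [← mul_assoc, side_mul_gen, if_neg fun h => ih.1 h.2]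
    exact ⟨fun h => ih.1 ((Subgroup.mul_mem_cancel_right _ (gen_mem Γ hr)).1 h), ih.2⟩
  exact this.2

theorem side_eq_sign {s : V} {w : W Γ} (hw : w ∈ star Γ s) : side Γ s w = sign Γ s w := by
  have : w ∈ star Γ s ∧ side Γ s w = sign Γ s w := by
    refine special_induction Γ (p := fun w => w ∈ star Γ s ∧ side Γ s w = sign Γ s w)
      (by simp [one_mem]) ?_ hw
    intro w r hr ih
    refine ⟨mul_mem ih.1 (gen_mem Γ hr), ?_⟩
    rw [side_mul_gen, map_mul, sign_gen, ih.2]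
    by_cases h : r = s <;> simp [h, ih.1]
  exact this.2

/-- The length of `w`, with respect to the standard generators. -/
abbrev len (w : W Γ) : ℕ := (coxeterMatrix Γ).toCoxeterSystem.length w

/-- The exchange property: the letter at which a word crosses the wall of `s` can be deleted. -/
theorem len_gen_mul_lt {s : V} {w : W Γ} (hw : side Γ s w ≠ 1) : len Γ (gen Γ s * w) < len Γ w := by
  have key : ∀ ω : List V, side Γ s ((coxeterMatrix Γ).toCoxeterSystem.wordProd ω) ≠ 1 →
      ∃ ω' : List V, ω'.length + 1 = ω.length ∧
        gen Γ s * (coxeterMatrix Γ).toCoxeterSystem.wordProd ω =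
          (coxeterMatrix Γ).toCoxeterSystem.wordProd ω' := by
    intro ω
    induction ω using List.reverseRecOn with
    | nil => simp
    | append_singleton ω r ih =>
      intro h
      rw [CoxeterSystem.wordProd_append, CoxeterSystem.wordProd_singleton] at h ⊢
      by_cases hs : side Γ s ((coxeterMatrix Γ).toCoxeterSystem.wordProd ω) = 1
      · rw [side_mul_gen, hs] at h
        split_ifs at h with h'
        · refine ⟨ω, by simp, ?_⟩
          rw [← mul_assoc, commute_of_mem_star Γ h'.2, h'.1, mul_assoc, gen_mul_gen, mul_one]
        · exact absurd rfl h
      · obtain ⟨ω', h1, h2⟩ := ih hs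
        refine ⟨ω' ++ [r], by simp [h1], ?_⟩
        rw [CoxeterSystem.wordProd_append, CoxeterSystem.wordProd_singleton, ← mul_assoc, h2]
  obtain ⟨ω, hω, rfl⟩ := (coxeterMatrix Γ).toCoxeterSystem.exists_isReduced w
  obtain ⟨ω', h1, h2⟩ := key ω hw
  rw [len, len, h2, hω.eq]
  exact ((coxeterMatrix Γ).toCoxeterSystem.length_wordProd_le ω').trans_lt (by lia)

/-- Only finitely many walls separate two given elements. -/
theorem exists_finite_walls (s : V) (k : W Γ) : ∃ E : Set (W Γ), E.Finite ∧
    ∀ x : W Γ, side Γ s (x⁻¹ * k) ≠ side Γ s x⁻¹ → ∃ e ∈ E, e⁻¹ * x ∈ star Γ s := by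
  induction k using (coxeterMatrix Γ).toCoxeterSystem.simple_induction_right with
  | one => exact ⟨∅, finite_empty, by simp⟩
  | mul_simple_right k r ih =>
    obtain ⟨E, hE, h⟩ := ih
    refine ⟨insert k E, hE.insert k, fun x hx => ?_⟩
    change side Γ s (x⁻¹ * (k * gen Γ r)) ≠ _ at hx
    rw [← mul_assoc, side_mul_gen] at hx
    split_ifs at hx with h'
    · exact ⟨k, mem_insert _ _, by simpa using inv_mem h'.2⟩
    · obtain ⟨e, he, he'⟩ := h x hx
      exact ⟨e, mem_insert_of_mem _ he, he'⟩

/-- If the special subgroup `W_H` and a conjugate `k W_{H'} k⁻¹` have infinite intersection, then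
`H ∩ H'` contains a pair of non-adjacent vertices `a`, `b` such that up to elements of `W_H` and
`W_{H'}` the conjugating element is a product of common neighbours of `a` and `b`. Namely, if `k`
is shortest in its double coset and starts with `s`, then the intersection permutes the finitely
many walls that separate `W_H` from `k W_{H'}`, so a subgroup of finite index in it commutes with
`s`. -/
theorem exists_nonadjacent_of_infinite [Finite V] (k : W Γ) : ∀ (H H' : Set V),
    {x | x ∈ special Γ H ∧ k⁻¹ * x * k ∈ special Γ H'}.Infinite →
    ∃ a ∈ H ∩ H', ∃ b ∈ H ∩ H', a ≠ b ∧ ¬ Γ.Adj a b ∧ ∃ p ∈ special Γ H,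
      ∃ q ∈ special Γ (Γ.neighborSet a ∩ Γ.neighborSet b), ∃ r ∈ special Γ H', k = p * q * r := by
  induction hn : len Γ k using Nat.strong_induction_on generalizing k with
  | _ n ih =>
  subst hn
  intro H H' hinf
  by_cases hmin : ∃ p ∈ special Γ H, ∃ r ∈ special Γ H', len Γ (p * k * r) < len Γ k
  · obtain ⟨p, hp, r, hr, hlt⟩ := hmin
    obtain ⟨a, ha, b, hb, hab, hadj, p', hp', q, hq, r', hr', h⟩ :=
      ih _ hlt (p * k * r) rfl H H' (by
        refine (hinf.image (f := fun x => p * x * p⁻¹)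
          ((MulAut.conj p).injective.injOn)).mono ?_
        rintro _ ⟨x, ⟨hx, hx'⟩, rfl⟩
        refine ⟨mul_mem (mul_mem hp hx) (inv_mem hp), ?_⟩
        have := mul_mem (mul_mem (inv_mem hr) hx') hr
        convert this using 1
        group)
    refine ⟨a, ha, b, hb, hab, hadj, p⁻¹ * p', mul_mem (inv_mem hp) hp', q, hq, r' * r⁻¹,
      mul_mem hr' (inv_mem hr), ?_⟩
    have : k = p⁻¹ * (p * k * r) * r⁻¹ := by group
    rw [this, h]
    group
  · push Not at hmin
    by_cases hk : k = 1
    · subst hk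
      have hcl : ¬ Γ.IsClique (H ∩ H') := fun hc => hinf ((finite_special Γ hc).subset (by
        rintro x ⟨hx, hx'⟩
        exact mem_special_inter Γ hx (by simpa using hx')))
      rw [SimpleGraph.isClique_iff, Set.Pairwise] at hcl
      push Not at hcl
      obtain ⟨a, ha, b, hb, hab, hadj⟩ := hcl
      exact ⟨a, ha, b, hb, hab, hadj, 1, one_mem _, 1, one_mem _, 1, one_mem _, by simp⟩
    · obtain ⟨s, hs⟩ := (coxeterMatrix Γ).toCoxeterSystem.exists_leftDescent_of_ne_one hk
      replace hs : len Γ (gen Γ s * k) < len Γ k := hs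
      have hsH : s ∉ H := fun h => absurd (hmin _ (gen_mem Γ h) 1 (one_mem _)) (by simpa using hs)
      have hk1 : side Γ s k = -1 := by
        refine (Int.units_eq_one_or _).resolve_left fun h => ?_
        have := len_gen_mul_lt Γ (s := s) (w := gen Γ s * k) (by rw [side_gen_mul, h]; decide)
        rw [← mul_assoc, gen_mul_gen, one_mul] at this
        lia
      -- The coset `k W_{H'}` does not cross the wall, for a crossing would show that `s k` is in
      -- this coset.
      have hk2 : ∀ u ∈ special Γ H', side Γ s (k * u) = -1 := by
        intro u hu
        have : u ∈ special Γ H' ∧ side Γ s (k * u) = -1 := by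
          refine special_induction Γ (p := fun u => u ∈ special Γ H' ∧ side Γ s (k * u) = -1)
            (by simpa [one_mem] using hk1) ?_ hu
          intro u r hr ih
          refine ⟨mul_mem ih.1 (gen_mem Γ hr), ?_⟩
          rw [← mul_assoc, side_mul_gen, if_neg, ih.2]
          rintro ⟨rfl, h⟩
          have h1 := commute_of_mem_star Γ h
          have h2 : gen Γ r * k = 1 * k * (u * gen Γ r * u⁻¹) := by
            rw [one_mul, ← mul_assoc, ← mul_assoc, ← h1]; group
          have h3 := hmin 1 (one_mem _) (u * gen Γ r * u⁻¹)
            (mul_mem (mul_mem ih.1 (gen_mem Γ hr)) (inv_mem ih.1))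
          rw [← h2] at h3
          lia
        exact this.2
      obtain ⟨E, hE, hE'⟩ := exists_finite_walls Γ s k
      have hcover : {x | x ∈ special Γ H ∧ k⁻¹ * x * k ∈ special Γ H'} ⊆
          ⋃ e ∈ E, {x | (x ∈ special Γ H ∧ k⁻¹ * x * k ∈ special Γ H') ∧ e⁻¹ * x ∈ star Γ s} := by
        rintro x ⟨hx, hx'⟩
        obtain ⟨e, he, he'⟩ := hE' x (by
          have h1 := hk2 _ (inv_mem hx')
          have h2 := side_mul_of_notMem Γ hsH 1 (inv_mem hx)
          rw [one_mul, side_one] at h2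
          rw [h2, show x⁻¹ * k = k * (k⁻¹ * x * k)⁻¹ by group, h1]
          decide)
        exact mem_biUnion he ⟨⟨hx, hx'⟩, he'⟩
      obtain ⟨e, he, hinf'⟩ : ∃ e ∈ E,
          {x | (x ∈ special Γ H ∧ k⁻¹ * x * k ∈ special Γ H') ∧ e⁻¹ * x ∈ star Γ s}.Infinite := by
        by_contra h
        push Not at h
        exact hinf ((hE.biUnion h).subset hcover)
      obtain ⟨x₀, ⟨hx₀, hx₀'⟩, hx₀''⟩ := hinf'.nonempty
      obtain ⟨a, ha, b, hb, hab, hadj, p, hp, q, hq, r, hr, h⟩ := ih _ hs (gen Γ s * k) rfl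
        (H ∩ Γ.neighborSet s) H' (by
          refine (hinf'.image (f := fun x => x₀⁻¹ * x) (mul_right_injective _).injOn).mono ?_
          rintro _ ⟨x, ⟨⟨hx, hx'⟩, hx''⟩, rfl⟩
          have hz : x₀⁻¹ * x ∈ star Γ s := by
            have := mul_mem (inv_mem hx₀'') hx''
            convert this using 1
            group
          refine ⟨?_, ?_⟩
          · refine special_mono Γ ?_ (mem_special_inter Γ (mul_mem (inv_mem hx₀) hx) hz)
            rintro v ⟨hv, rfl | hv'⟩
            · exact absurd hv hsH
            · exact ⟨hv, hv'⟩
          · have := mul_mem (inv_mem hx₀') hx'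
            convert this using 1
            rw [mul_inv_rev, gen_inv, mul_assoc, mul_assoc k⁻¹, ← mul_assoc (x₀⁻¹ * x),
              ← commute_of_mem_star Γ hz, ← mul_assoc (gen Γ s), ← mul_assoc (gen Γ s),
              gen_mul_gen]
            group)
      refine ⟨a, ⟨ha.1.1, ha.2⟩, b, ⟨hb.1.1, hb.2⟩, hab, hadj, p,
        special_mono Γ inter_subset_left hp, gen Γ s * q,
        mul_mem (gen_mem Γ ⟨ha.1.2.symm, hb.1.2.symm⟩) hq, r, hr, ?_⟩
      have hsp : gen Γ s * p = p * gen Γ s := commute_of_mem_star Γ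
        (special_mono Γ (fun v hv => mem_insert_of_mem _ hv.2) hp)
      calc k = gen Γ s * (gen Γ s * k) := by rw [← mul_assoc, gen_mul_gen, one_mul]
        _ = (gen Γ s * p) * q * r := by rw [h]; group
        _ = p * (gen Γ s * q) * r := by rw [hsp]; group

end Group

/-! ### Hyperedges -/

section Hypergraphs

variable {V : Type*} {Γ : SimpleGraph V}

/-- A strip has only one pair of non-adjacent vertices. -/
theorem IsStripJoin.mem_pair {S : Set V} (hS : IsStripJoin Γ S) {x y z w : V} (hx : x ∈ S)
    (hy : y ∈ S) (hz : z ∈ S) (hw : w ∈ S) (hxy : x ≠ y) (hxy' : ¬ Γ.Adj x y) (hzw : z ≠ w)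
    (hzw' : ¬ Γ.Adj z w) : z = x ∨ z = y := by
  obtain ⟨a, b, K, -, -, -, hK, rfl, hj⟩ := hS
  have key : ∀ {x y : V}, x ∈ {a, b} ∪ K → y ∈ {a, b} ∪ K → x ≠ y → ¬ Γ.Adj x y →
      x = a ∧ y = b ∨ x = b ∧ y = a := by
    intro x y hx hy hne hadj
    rcases hx with hx | hx <;> rcases hy with hy | hy
    · rcases hx with rfl | rfl <;> rcases hy with rfl | rfl <;> simp_all
    · exact absurd (hj x hx y hy) hadj
    · exact absurd (hj y hy x hx).symm hadj
    · exact absurd (hK hx hy hne) hadj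
  have h1 := key hx hy hxy hxy'
  have h2 := key hz hw hzw hzw'
  grind

theorem IsWideJoin.not_subset_strip {L S : Set V} (hL : IsWideJoin Γ L) (hS : IsStripJoin Γ S) :
    ¬ L ⊆ S := by
  obtain ⟨A, B, ⟨rfl, hj⟩, ⟨a, ha, a', ha', hne, hadj⟩, ⟨b, hb, b', hb', hne', hadj'⟩⟩ := hL
  intro h
  rcases hS.mem_pair (h (Or.inl ha)) (h (Or.inl ha')) (h (Or.inr hb)) (h (Or.inr hb')) hne hadj
    hne' hadj' with rfl | rfl
  · exact Γ.irrefl (hj _ ha _ hb)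
  · exact Γ.irrefl (hj _ ha' _ hb)

theorem IsWideJoin.notMem_strip {L H : Set V} (hL : IsWideJoin Γ L) (h : L ⊆ H) :
    H ∉ stripSubgraphs Γ := fun hH => hL.not_subset_strip hH.1 h

theorem IsWideJoin.exists_wide [Finite V] {L : Set V} (hL : IsWideJoin Γ L) :
    ∃ L' ∈ wideSubgraphs Γ, L ⊆ L' := by
  obtain ⟨L', h1, h2⟩ := (toFinite {L | IsWideJoin Γ L}).exists_le_maximal hL
  exact ⟨L', h2, h1⟩

theorem eq_of_strip [Finite V] {S S' : Set V} (hS : S ∈ stripSubgraphs Γ)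
    (hS' : S' ∈ stripSubgraphs Γ) (h : HasNonadjacentPair Γ (S ∩ S')) : S = S' := by
  obtain ⟨x, hx, y, hy, hxy, hadj⟩ := h
  have key : ∀ {S : Set V}, IsStripJoin Γ S → x ∈ S → y ∈ S →
      ∃ K, K.Nonempty ∧ Γ.IsClique K ∧ IsJoin Γ S {x, y} K := by
    intro S h hx hy
    have h' := h
    obtain ⟨a, b, K, hab, hadj', hKn, hK, hj⟩ := h
    refine ⟨K, hKn, hK, ?_⟩
    have ha : a ∈ S := by rw [hj.1]; simp
    have hb : b ∈ S := by rw [hj.1]; simp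
    have h1 := h'.mem_pair hx hy ha hb hxy hadj hab hadj'
    have h2 := h'.mem_pair hx hy hb ha hxy hadj hab.symm (fun h => hadj' h.symm)
    have : ({x, y} : Set V) = {a, b} := by
      rcases h1 with rfl | rfl <;> rcases h2 with rfl | rfl
      · exact absurd rfl hab
      · rfl
      · exact pair_comm _ _
      · exact absurd rfl hab
    rwa [this]
  obtain ⟨K, hKn, hK, hSK, hj⟩ := key hS.1 hx.1 hy.1
  obtain ⟨K', hKn', hK', hSK', hj'⟩ := key hS'.1 hx.2 hy.2
  have hJ : IsJoin Γ ({x, y} ∪ (K ∪ K')) {x, y} (K ∪ K') :=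
    ⟨rfl, fun a ha b hb => hb.elim (hj a ha b) (hj' a ha b)⟩
  have hsub : S ⊆ {x, y} ∪ (K ∪ K') := by
    rw [hSK]; exact union_subset_union_right _ subset_union_left
  have hsub' : S' ⊆ {x, y} ∪ (K ∪ K') := by
    rw [hSK']; exact union_subset_union_right _ subset_union_right
  by_cases hc : Γ.IsClique (K ∪ K')
  · have hs : IsStripJoin Γ ({x, y} ∪ (K ∪ K')) :=
      ⟨x, y, _, hxy, hadj, hKn.mono subset_union_left, hc, hJ⟩
    rw [hS.2 _ (Or.inr hs) hsub, ← hS'.2 _ (Or.inr hs) hsub']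
  · rw [SimpleGraph.isClique_iff, Set.Pairwise] at hc
    push Not at hc
    obtain ⟨k, hk, k', hk', hkk', hadj'⟩ := hc
    have hw : IsWideJoin Γ ({x, y} ∪ (K ∪ K')) :=
      ⟨_, _, hJ, ⟨x, by simp, y, by simp, hxy, hadj⟩, k, hk, k', hk', hkk', hadj'⟩
    obtain ⟨L, hL, hL'⟩ := hw.exists_wide
    have := hS.2 L (Or.inl hL) (hsub.trans hL')
    exact absurd this.ge (hL.1.not_subset_strip hS.1)

theorem exists_mem_lambdaHyperedges_zero [Finite V] {a b k : V} (hab : a ≠ b)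
    (hadj : ¬ Γ.Adj a b) (ha : Γ.Adj a k) (hb : Γ.Adj b k) :
    ∃ E ∈ lambdaHyperedges Γ 0, a ∈ E ∧ b ∈ E ∧ k ∈ E := by
  have hs : IsStripJoin Γ ({a, b} ∪ {k}) := by
    refine ⟨a, b, {k}, hab, hadj, by simp, by simp, rfl, ?_⟩
    rintro x (rfl | rfl) y rfl <;> assumption
  obtain ⟨S, hsub, hS⟩ := (toFinite {L | IsStripJoin Γ L}).exists_le_maximal hs
  by_cases hw : ∃ L ∈ wideSubgraphs Γ, S ⊆ L
  · obtain ⟨L, hL, hSL⟩ := hw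
    exact ⟨L, Or.inl hL, hSL (hsub (by simp)), hSL (hsub (by simp)), hSL (hsub (by simp))⟩
  · push Not at hw
    refine ⟨S, Or.inr ⟨hS.1, ?_⟩, hsub (by simp), hsub (by simp), hsub (by simp)⟩
    rintro L' (hL' | hL') h
    · exact absurd h (hw L' hL')
    · exact h.antisymm (hS.2 hL' h)

variable (Γ) in
/-- The union of the equivalence class of the hyperedge `H` in the set `E` of hyperedges. -/
def classUnion (E : Set (Set V)) (H : Set V) : Set V := ⋃₀ {H' ∈ E | HyperedgeEquiv Γ E H H'}

theorem classUnion_mem {i : ℕ} {H : Set V} (hH : H ∈ lambdaHyperedges Γ i) :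
    classUnion Γ (lambdaHyperedges Γ i) H ∈ lambdaHyperedges Γ (i + 1) := ⟨H, hH, rfl⟩

theorem subset_classUnion {E : Set (Set V)} {H H' : Set V} (hH' : H' ∈ E)
    (h : HyperedgeEquiv Γ E H H') : H' ⊆ classUnion Γ E H := subset_sUnion_of_mem ⟨hH', h⟩

theorem HyperedgeEquiv.symm {E : Set (Set V)} {H H' : Set V} (h : HyperedgeEquiv Γ E H H') :
    HyperedgeEquiv Γ E H' H := by
  induction h with
  | refl => exact .refl
  | tail _ h ih => exact .head ⟨h.2.1, h.1, by rw [inter_comm]; exact h.2.2⟩ ih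

theorem HyperedgeEquiv.mono {E E' : Set (Set V)} (hE : E ⊆ E') {H H' : Set V}
    (h : HyperedgeEquiv Γ E H H') : HyperedgeEquiv Γ E' H H' := by
  induction h with
  | refl => exact .refl
  | tail _ h ih => exact ih.tail ⟨hE h.1, hE h.2.1, h.2.2⟩

theorem HyperedgeEquiv.mem {E : Set (Set V)} {H H' : Set V} (h : HyperedgeEquiv Γ E H H')
    (hH : H ∈ E) : H' ∈ E := by
  rcases Relation.ReflTransGen.cases_tail h with rfl | ⟨_, -, h⟩
  exacts [hH, h.2.1]

theorem classUnion_congr {E : Set (Set V)} {H H' : Set V} (h : HyperedgeEquiv Γ E H H') :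
    classUnion Γ E H = classUnion Γ E H' := by
  unfold classUnion
  congr 1
  ext K
  exact and_congr_right fun _ => ⟨h.symm.trans, h.trans⟩

theorem exists_superset_mem_lambdaHyperedges {E : Set V} (hE : E ∈ lambdaHyperedges Γ 0) (i : ℕ) :
    ∃ H ∈ lambdaHyperedges Γ i, E ⊆ H := by
  induction i with
  | zero => exact ⟨E, hE, subset_rfl⟩
  | succ i ih =>
    obtain ⟨H, hH, hEH⟩ := ih
    exact ⟨_, classUnion_mem hH, hEH.trans (subset_classUnion hH .refl)⟩

/-- The common neighbours of a pair of non-adjacent vertices of a hyperedge belong to the union of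
the class of this hyperedge. -/
theorem mem_classUnion_of_adj [Finite V] {i : ℕ} {H : Set V} (hH : H ∈ lambdaHyperedges Γ i)
    {a b k : V} (ha : a ∈ H) (hb : b ∈ H) (hab : a ≠ b) (hadj : ¬ Γ.Adj a b) (hak : Γ.Adj a k)
    (hbk : Γ.Adj b k) : k ∈ classUnion Γ (lambdaHyperedges Γ i) H := by
  obtain ⟨E, hE, haE, hbE, hkE⟩ := exists_mem_lambdaHyperedges_zero hab hadj hak hbk
  obtain ⟨H', hH', hEH'⟩ := exists_superset_mem_lambdaHyperedges hE i
  exact subset_classUnion hH' (.single ⟨hH, hH', a, ⟨ha, hEH' haE⟩, b, ⟨hb, hEH' hbE⟩, hab, hadj⟩)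
    (hEH' hkE)

theorem exists_notMem_strip (hw : (wideSubgraphs Γ).Nonempty) (i : ℕ) :
    ∃ H ∈ lambdaHyperedges Γ i, H ∉ stripSubgraphs Γ := by
  obtain ⟨L, hL⟩ := hw
  obtain ⟨H, hH, hLH⟩ := exists_superset_mem_lambdaHyperedges (Or.inl hL) i
  exact ⟨H, hH, hL.1.notMem_strip hLH⟩

/-- A vertex that is adjacent to all the others belongs to all hyperedges. -/
theorem mem_of_forall_adj {v : V} (hv : ∀ b, b ≠ v → Γ.Adj v b) {i : ℕ} {H : Set V}
    (hH : H ∈ lambdaHyperedges Γ i) : v ∈ H := by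
  induction i generalizing H with
  | zero =>
    by_contra hvH
    rcases hH with hH | hH
    · obtain ⟨A, B, ⟨rfl, hj⟩, hA, b, hb, hb'⟩ := hH.1
      have h1 : IsWideJoin Γ (insert v A ∪ B) := by
        refine ⟨insert v A, B, ⟨rfl, ?_⟩, ?_, b, hb, hb'⟩
        · rintro a (rfl | ha) b hb
          · exact hv b (by rintro rfl; exact hvH (Or.inr hb))
          · exact hj a ha b hb
        · obtain ⟨a, ha, a', ha', h⟩ := hA
          exact ⟨a, Or.inr ha, a', Or.inr ha', h⟩
      exact hvH (hH.2 h1 (union_subset_union_left _ (subset_insert _ _)) (by simp))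
    · obtain ⟨a, b, K, hab, hadj, hKn, hK, rfl, hj⟩ := hH.1
      have h1 : IsStripJoin Γ ({a, b} ∪ insert v K) := by
        refine ⟨a, b, insert v K, hab, hadj, insert_nonempty _ _, ?_, rfl, ?_⟩
        · exact hK.insert fun c _ hc => hv c hc.symm
        · rintro c hc d (rfl | hd)
          · exact (hv c (by rintro rfl; exact hvH (Or.inl hc))).symm
          · exact hj c hc d hd
      have := hH.2 _ (Or.inr h1) (union_subset_union_right _ (subset_insert _ _))
      rw [this] at hvH
      simp at hvH
  | succ i ih =>
    obtain ⟨K, hK, rfl⟩ := hH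
    exact subset_classUnion hK .refl (ih hK)

theorem exists_classUnion_eq [Finite V] {i : ℕ} {F : Set V}
    (hF : F ∈ lambdaHyperedges Γ (i + 1)) (hF' : F ∉ stripSubgraphs Γ) :
    ∃ H ∈ lambdaHyperedges Γ i, H ∉ stripSubgraphs Γ ∧
      F = classUnion Γ (lambdaHyperedges Γ i) H := by
  obtain ⟨H, hH, rfl⟩ := hF
  change classUnion Γ (lambdaHyperedges Γ i) H ∉ _ at hF'
  change ∃ H' ∈ _, _ ∧ classUnion Γ (lambdaHyperedges Γ i) H = _
  by_cases h : ∃ H', HyperedgeEquiv Γ (lambdaHyperedges Γ i) H H' ∧ H' ∉ stripSubgraphs Γ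
  · obtain ⟨H', h1, h2⟩ := h
    exact ⟨H', h1.mem hH, h2, classUnion_congr h1⟩
  · -- A class that consists of strips consists of a single strip.
    push Not at h
    have key : ∀ H', HyperedgeEquiv Γ (lambdaHyperedges Γ i) H H' → H = H' := by
      intro H' h'
      induction h' with
      | refl => rfl
      | tail h1 h2 ih =>
        subst ih
        exact eq_of_strip (h _ h1) (h _ (h1.tail h2)) h2.2.2
    refine absurd ?_ hF'
    have : classUnion Γ (lambdaHyperedges Γ i) H = H := by
      refine Subset.antisymm ?_ (subset_classUnion hH .refl)
      rintro x ⟨H', ⟨-, h1⟩, hx⟩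
      rwa [key H' h1]
    rw [this]
    exact h H .refl

/-- Strips can be avoided in chains of hyperedges: the non-adjacent pair of a strip belongs to the
hyperedge before it. -/
theorem HyperedgeEquiv.exists_notMem_strip {E : Set (Set V)} {H H' : Set V}
    (h : HyperedgeEquiv Γ E H H') (hH : H ∈ E) (hH' : H ∉ stripSubgraphs Γ) :
    ∃ K ∈ E \ stripSubgraphs Γ, HyperedgeEquiv Γ (E \ stripSubgraphs Γ) H K ∧
      (H' ∉ stripSubgraphs Γ → K = H') ∧ ∀ a ∈ H', ∀ b ∈ H', a ≠ b → ¬ Γ.Adj a b → a ∈ K := by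
  induction h with
  | refl => exact ⟨H, ⟨hH, hH'⟩, .refl, fun _ => rfl, fun a ha _ _ _ _ => ha⟩
  | @tail H₁ H₂ _ h2 ih =>
    obtain ⟨K, hK, hHK, -, hK'⟩ := ih
    obtain ⟨a, ha, b, hb, hab, hadj⟩ := h2.2.2
    have haK := hK' a ha.1 b hb.1 hab hadj
    have hbK := hK' b hb.1 a ha.1 hab.symm fun h => hadj h.symm
    by_cases hs : H₂ ∈ stripSubgraphs Γ
    · refine ⟨K, hK, hHK, fun h => absurd hs h, fun c hc d hd hcd hcd' => ?_⟩
      rcases hs.1.mem_pair ha.2 hb.2 hc hd hab hadj hcd hcd' with rfl | rfl <;> assumption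
    · exact ⟨H₂, ⟨h2.2.1, hs⟩, hHK.tail ⟨hK, ⟨h2.2.1, hs⟩, a, ⟨haK, ha.2⟩, b, ⟨hbK, hb.2⟩, hab,
        hadj⟩, fun _ => rfl, fun a ha _ _ _ _ => ha⟩

end Hypergraphs

/-! ### The metric of the Davis complex -/

section Metric

variable {V : Type*} {Γ : SimpleGraph V}

/-- The image of a point of the chamber under the coordinate projection to `H`. -/
def Chamber.restrict (t : Chamber Γ) (H : Set V) : Chamber Γ where
  coord := H.indicator t.coord
  nonneg s := indicator_nonneg (fun s _ => t.nonneg s) s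
  le_half s := (indicator_le_self' (fun s _ => t.nonneg s) s).trans (t.le_half s)
  isClique := SimpleGraph.IsClique.subset
    (fun s (hs : H.indicator t.coord s ≠ 0) (h : t.coord s = 0) => hs (by simp [h])) t.isClique

theorem Chamber.restrict_coord_of_mem (t : Chamber Γ) {H : Set V} {s : V} (hs : s ∈ H) :
    (t.restrict H).coord s = t.coord s := indicator_of_mem hs t.coord

theorem Chamber.restrict_coord_of_notMem (t : Chamber Γ) {H : Set V} {s : V} (hs : s ∉ H) :
    (t.restrict H).coord s = 0 := indicator_of_notMem hs t.coord

theorem Chamber.support_restrict (t : Chamber Γ) (H : Set V) :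
    (t.restrict H).support ⊆ t.support ∩ H := by
  intro s hs
  by_cases h : s ∈ H
  · exact ⟨by rwa [support, mem_ofPred_eq, restrict_coord_of_mem t h] at hs, h⟩
  · exact absurd (restrict_coord_of_notMem t h) hs

theorem Chamber.restrict_eq_self {t : Chamber Γ} {H : Set V} (h : t.support ⊆ H) :
    t.restrict H = t := by
  ext s
  by_cases hs : s ∈ H
  · exact restrict_coord_of_mem t hs
  · rw [restrict_coord_of_notMem t hs]
    by_contra h'
    exact hs (h (Ne.symm h'))

theorem Chamber.mirrors_subset_support (t : Chamber Γ) : t.mirrors ⊆ t.support := by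
  intro s hs
  rw [support, mem_ofPred_eq, show t.coord s = 1 / 2 from hs]
  norm_num

/-- The retraction of the Davis complex onto the subcomplex of the coset `u W_H` that is induced
by the retraction `restrict Γ H` of the group. -/
def retract (u : W Γ) (H : Set V) (x : Davis Γ) : Davis Γ :=
  Quotient.lift (s := davisSetoid Γ)
    (fun p : W Γ × Chamber Γ => Davis.mk (u * restrict Γ H (u⁻¹ * p.1)) (p.2.restrict H))
    (by
      rintro ⟨g, t⟩ ⟨h, t'⟩ ⟨h0, h1⟩
      dsimp only at h0 h1 ⊢
      subst h0
      refine Davis.mk_eq_iff.2 ⟨rfl, ?_⟩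
      have h2 := special_mono Γ (U := (t.restrict H).mirrors) (fun s hs => ?_)
        (restrict_mem Γ H h1)
      · convert h2 using 1
        simp only [mul_inv_rev, map_mul, map_inv]
        group
      · exact (t.restrict_coord_of_mem hs.2).trans hs.1)
    x

theorem retract_mk (u g : W Γ) (H : Set V) (t : Chamber Γ) :
    retract u H (Davis.mk g t) = Davis.mk (u * restrict Γ H (u⁻¹ * g)) (t.restrict H) := rfl

theorem mk_mem_subcomplex {g w : W Γ} {H : Set V} {t : Chamber Γ} (h : g⁻¹ * w ∈ special Γ H)
    (ht : t.support ⊆ H) : Davis.mk w t ∈ subcomplex g H := ⟨w, t, h, ht, rfl⟩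

theorem subcomplex_mono (g : W Γ) {H H' : Set V} (h : H ⊆ H') :
    subcomplex g H ⊆ subcomplex g H' := by
  rintro _ ⟨w, t, h1, h2, rfl⟩
  exact mk_mem_subcomplex (special_mono Γ h h1) (h2.trans h)

theorem subcomplex_subset {g g' : W Γ} {H : Set V} (h : g⁻¹ * g' ∈ special Γ H) :
    subcomplex g' H ⊆ subcomplex g H := by
  rintro _ ⟨w, t, h1, h2, rfl⟩
  exact mk_mem_subcomplex (by simpa [mul_assoc] using mul_mem h h1) h2

theorem subcomplex_congr {g g' : W Γ} {H : Set V} (h : g⁻¹ * g' ∈ special Γ H) :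
    subcomplex g' H = subcomplex g H :=
  (subcomplex_subset h).antisymm (subcomplex_subset (by simpa using inv_mem h))

theorem subcomplex_univ (g : W Γ) : subcomplex g (univ : Set V) = univ := by
  refine eq_univ_of_forall fun x => ?_
  obtain ⟨w, t, rfl⟩ := x.exists_rep
  exact mk_mem_subcomplex (mem_special_univ Γ _) (subset_univ _)

theorem mk_zero_mem_subcomplex {g w : W Γ} {H : Set V} (h : g⁻¹ * w ∈ special Γ H) :
    Davis.mk w Chamber.zero ∈ subcomplex g H :=
  mk_mem_subcomplex h (by simp [Chamber.support, Chamber.zero])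

theorem retract_mem (u : W Γ) (H : Set V) (x : Davis Γ) : retract u H x ∈ subcomplex u H := by
  obtain ⟨g, t, rfl⟩ := x.exists_rep
  rw [retract_mk]
  refine mk_mem_subcomplex ?_ ((t.support_restrict H).trans inter_subset_right)
  rw [inv_mul_cancel_left]
  exact restrict_mem_special Γ H _

theorem retract_mem_inter (u : W Γ) (H : Set V) {H' : Set V} {x : Davis Γ}
    (hx : x ∈ subcomplex u H') : retract u H x ∈ subcomplex u (H' ∩ H) := by
  obtain ⟨g, t, hg, ht, rfl⟩ := hx
  rw [retract_mk]
  refine mk_mem_subcomplex ?_ ((t.support_restrict H).trans (inter_subset_inter_left _ ht))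
  rw [inv_mul_cancel_left]
  exact restrict_mem Γ H hg

theorem retract_eq_self {u : W Γ} {H : Set V} {x : Davis Γ} (hx : x ∈ subcomplex u H) :
    retract u H x = x := by
  obtain ⟨g, t, hg, ht, rfl⟩ := hx
  rw [retract_mk, restrict_eq_self Γ hg, mul_inv_cancel_left, Chamber.restrict_eq_self ht]

theorem fold_retract_of_mem (u : W Γ) {H : Set V} {s : V} (hs : s ∈ H) (x : Davis Γ) :
    fold (retract u H x) s = fold x s := by
  obtain ⟨g, t, rfl⟩ := x.exists_rep
  rw [retract_mk, fold_mk, fold_mk, Chamber.restrict_coord_of_mem t hs, map_mul,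
    sign_restrict_of_mem Γ hs, ← map_mul, mul_inv_cancel_left]

theorem fold_retract_of_notMem (u : W Γ) {H : Set V} {s : V} (hs : s ∉ H) (x : Davis Γ) :
    fold (retract u H x) s = ((sign Γ s u : ℤ) : ℝ) * (1 / 2) := by
  obtain ⟨g, t, rfl⟩ := x.exists_rep
  rw [retract_mk, fold_mk, Chamber.restrict_coord_of_notMem t hs, map_mul,
    sign_eq_one Γ hs (restrict_mem_special Γ H _), mul_one, sub_zero]

theorem SameCube.retract (u : W Γ) (H : Set V) {x y : Davis Γ} (h : SameCube x y) :
    SameCube (retract u H x) (retract u H y) := by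
  obtain ⟨g, T, hT, h1, h2⟩ := h
  have key : ∀ z ∈ subcomplex g T,
      RACG.retract u H z ∈ subcomplex (u * restrict Γ H (u⁻¹ * g)) (T ∩ H) := by
    rintro _ ⟨w, t, hw, ht, rfl⟩
    rw [retract_mk]
    refine mk_mem_subcomplex ?_ ((t.support_restrict H).trans (inter_subset_inter_left _ ht))
    convert restrict_mem Γ H hw using 1
    simp only [mul_inv_rev, map_mul, map_inv]
    group
  exact ⟨_, _, hT.subset inter_subset_left, key x h1, key y h2⟩

theorem abs_fold_le (x : Davis Γ) (s : V) : |fold x s| ≤ 1 / 2 := by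
  obtain ⟨g, t, rfl⟩ := x.exists_rep
  rw [abs_fold_mk]
  linarith [t.nonneg s]

theorem fold_of_notMem {b : W Γ} {T : Set V} {x : Davis Γ} (hx : x ∈ subcomplex b T) {s : V}
    (hs : s ∉ T) : fold x s = ((sign Γ s b : ℤ) : ℝ) * (1 / 2) := by
  rw [← retract_eq_self hx, fold_retract_of_notMem b hs]

variable [Fintype V]

theorem dist_le_dist_of_abs {a b c d : EuclideanSpace ℝ V}
    (h : ∀ s, |a s - b s| ≤ |c s - d s|) : dist a b ≤ dist c d := by
  rw [EuclideanSpace.dist_eq, EuclideanSpace.dist_eq]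
  gcongr with s
  exact h s

theorem dist_le_of_isString {x y : Davis Γ} {l : ℝ} (h : IsString x y l) : dist x y ≤ l :=
  csInf_le ⟨0, fun _ h => IsString.nonneg h⟩ h

theorem exists_isString_of_dist_lt {x y : Davis Γ} {r : ℝ} (h : dist x y < r) :
    ∃ l < r, IsString x y l := by
  obtain ⟨l, h1, h2⟩ := exists_lt_of_csInf_lt (exists_isString x y) h
  exact ⟨l, h2, h1⟩

theorem SameCube.dist_le {x y : Davis Γ} (h : SameCube x y) : dist x y ≤ dist (fold x) (fold y) :=
  dist_le_of_isString (.single h)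

theorem SameCube.dist_le_sqrt {x y : Davis Γ} (h : SameCube x y) :
    dist x y ≤ √(Fintype.card V) := by
  refine h.dist_le.trans ?_
  rw [EuclideanSpace.dist_eq]
  gcongr
  calc ∑ s, dist (fold x s) (fold y s) ^ 2 ≤ ∑ _s : V, (1 : ℝ) := by
        gcongr with s
        refine pow_le_one₀ dist_nonneg ?_
        rw [Real.dist_eq]
        have h1 := abs_fold_le x s
        have h2 := abs_fold_le y s
        have := abs_sub (fold x s) (fold y s)
        linarith
    _ = Fintype.card V := by simp

theorem dist_mk_zero_le (g : W Γ) (t : Chamber Γ) :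
    dist (Davis.mk g t) (Davis.mk g Chamber.zero) ≤ √(Fintype.card V) :=
  SameCube.dist_le_sqrt ⟨g, t.support, t.isClique, mk_mem_subcomplex (by simp [one_mem]) subset_rfl,
    mk_zero_mem_subcomplex (by simp [one_mem])⟩

theorem dist_retract_le (u : W Γ) (H : Set V) (x y : Davis Γ) :
    dist (retract u H x) (retract u H y) ≤ dist x y := by
  have key : ∀ {l : ℝ}, IsString x y l → dist (retract u H x) (retract u H y) ≤ l := by
    intro l h
    induction h with
    | refl => simp
    | @step y z l _ hc ih =>
      refine (dist_triangle _ (retract u H y) _).trans (add_le_add ih ?_)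
      refine (hc.retract u H).dist_le.trans (dist_le_dist_of_abs fun s => ?_)
      by_cases hs : s ∈ H
      · rw [fold_retract_of_mem u hs, fold_retract_of_mem u hs]
      · rw [fold_retract_of_notMem u hs, fold_retract_of_notMem u hs, sub_self, abs_zero]
        exact abs_nonneg _
  refine le_of_forall_gt fun r hr => ?_
  obtain ⟨l, hl, h⟩ := exists_isString_of_dist_lt hr
  exact (key h).trans_lt hl

theorem continuous_retract (u : W Γ) (H : Set V) : Continuous (retract (Γ := Γ) u H) :=
  (LipschitzWith.mk_one (dist_retract_le u H)).continuous

/-! ### Paths in the Davis complex -/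

theorem exists_mem_special_sign {T : Set V} (U : Set V) (hU : U ⊆ T) :
    ∃ w ∈ special Γ T, ∀ s, (s ∈ U → sign Γ s w = -1) ∧ (s ∉ U → sign Γ s w = 1) := by
  induction U, U.toFinite using Set.Finite.induction_on with
  | empty => exact ⟨1, one_mem _, by simp⟩
  | @insert a U ha _ ih =>
    obtain ⟨w, hw, h⟩ := ih ((subset_insert _ _).trans hU)
    refine ⟨w * gen Γ a, mul_mem hw (gen_mem Γ (hU (mem_insert _ _))), fun s => ?_⟩
    rw [map_mul, sign_gen]
    by_cases hs : s = a
    · subst hs; simp [(h s).2 ha]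
    · simp only [mem_insert_iff, hs, false_or, if_neg (Ne.symm hs), mul_one]
      exact h s

theorem exists_mem_subcomplex_fold_eq (b : W Γ) {T : Set V} (hT : Γ.IsClique T)
    (f : EuclideanSpace ℝ V) (hf : ∀ s, |f s| ≤ 1 / 2)
    (hfT : ∀ s ∉ T, f s = ((sign Γ s b : ℤ) : ℝ) * (1 / 2)) :
    ∃ x ∈ subcomplex b T, fold x = f := by
  obtain ⟨w, hw, h⟩ := exists_mem_special_sign (Γ := Γ)
    {s ∈ T | ((sign Γ s b : ℤ) : ℝ) * f s < 0} (sep_subset _ _)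
  have habs : ∀ s ∉ T, |f s| = 1 / 2 := by
    intro s hs
    rw [hfT s hs, abs_mul, abs_sign]
    norm_num
  let t : Chamber Γ :=
    { coord := fun s => 1 / 2 - |f s|
      nonneg := fun s => by linarith [hf s]
      le_half := fun s => by linarith [abs_nonneg (f s)]
      isClique := hT.subset fun s hs => by
        by_contra h
        exact hs (by rw [habs s h, sub_self]) }
  refine ⟨Davis.mk (b * w) t, mk_mem_subcomplex (by simpa using hw) fun s hs => ?_, ?_⟩
  · by_contra h
    exact hs (by change 1 / 2 - |f s| = 0; rw [habs s h, sub_self])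
  · ext s
    rw [fold_mk, map_mul]
    change _ * (1 / 2 - (1 / 2 - |f s|)) = f s
    rw [sub_sub_cancel]
    by_cases hs : s ∈ {s ∈ T | ((sign Γ s b : ℤ) : ℝ) * f s < 0}
    · rw [(h s).1 hs]
      have h2 := hs.2
      rcases Int.units_eq_one_or (sign Γ s b) with h1 | h1 <;> rw [h1] at h2 ⊢ <;>
        norm_num at h2 ⊢
      · rw [abs_of_neg h2, neg_neg]
      · exact h2.le
    · rw [(h s).2 hs, mul_one]
      have h2 : 0 ≤ ((sign Γ s b : ℤ) : ℝ) * f s := by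
        by_contra h3
        by_cases hT' : s ∈ T
        · exact hs ⟨hT', not_le.1 h3⟩
        · rw [hfT s hT', ← mul_assoc] at h3
          exact h3 (mul_nonneg (mul_self_nonneg _) (by norm_num))
      rcases Int.units_eq_one_or (sign Γ s b) with h1 | h1 <;> rw [h1] at h2 ⊢ <;>
        norm_num at h2 ⊢
      · exact h2
      · rw [abs_of_nonpos h2, neg_neg]

/-- Two points of a cube are joined by a Euclidean segment. -/
theorem SameCube.exists_segment {x y : Davis Γ} (h : SameCube x y) : ∃ p : ℝ → Davis Γ,
    p 0 = x ∧ p 1 = y ∧ ∀ a ∈ Icc (0 : ℝ) 1, ∀ b ∈ Icc (0 : ℝ) 1,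
      dist (p a) (p b) ≤ |a - b| * dist (fold x) (fold y) := by
  obtain ⟨g, T, hT, hx, hy⟩ := h
  have key : ∀ a : ℝ, ∃ z, a ∈ Icc (0 : ℝ) 1 →
      z ∈ subcomplex g T ∧ fold z = AffineMap.lineMap (fold x) (fold y) a := by
    intro a
    by_cases ha : a ∈ Icc (0 : ℝ) 1
    · have hl : ∀ s, AffineMap.lineMap (fold x) (fold y) a s =
          (1 - a) * fold x s + a * fold y s := by
        intro s
        simp [AffineMap.lineMap_apply_module]
      have h1 : ∀ s, |AffineMap.lineMap (fold x) (fold y) a s| ≤ 1 / 2 := by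
        intro s
        rw [hl]
        have h1 := abs_le.1 (abs_fold_le x s)
        have h2 := abs_le.1 (abs_fold_le y s)
        rw [abs_le]
        constructor <;> nlinarith [ha.1, ha.2]
      obtain ⟨z, hz⟩ := exists_mem_subcomplex_fold_eq g hT
        (AffineMap.lineMap (fold x) (fold y) a) h1 (by
          intro s hs
          rw [hl, fold_of_notMem hx hs, fold_of_notMem hy hs]
          ring)
      exact ⟨z, fun _ => hz⟩
    · exact ⟨x, fun h => absurd h ha⟩
  choose p hp using key
  refine ⟨p, ?_, ?_, ?_⟩
  · have := hp 0 (by simp)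
    exact SameCube.eq_of_fold ⟨g, T, hT, this.1, hx⟩ (by simpa using this.2)
  · have := hp 1 (by simp)
    exact SameCube.eq_of_fold ⟨g, T, hT, this.1, hy⟩ (by simpa using this.2)
  · intro a ha b hb
    refine (SameCube.dist_le ⟨g, T, hT, (hp a ha).1, (hp b hb).1⟩).trans ?_
    rw [(hp a ha).2, (hp b hb).2, dist_lineMap_lineMap, Real.dist_eq]

theorem joinedIn_ball {x y : Davis Γ} {r : ℝ} (h : dist x y < r) : JoinedIn (ball x r) x y := by
  obtain ⟨l, hl, hs⟩ := exists_isString_of_dist_lt h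
  clear h
  induction hs with
  | refl => exact .refl (mem_ball_self hl)
  | @step y z l hs hc ih =>
    refine (ih (lt_of_le_of_lt (le_add_of_nonneg_right dist_nonneg) hl)).trans ?_
    obtain ⟨p, h0, h1, hp⟩ := hc.exists_segment
    refine JoinedIn.ofLine (f := p) ?_ h0 h1 ?_
    · refine (LipschitzOnWith.of_dist_le_mul (K := ⟨dist (fold y) (fold z), dist_nonneg⟩)
        fun a ha b hb => ?_).continuousOn
      rw [Real.dist_eq, mul_comm]
      exact hp a ha b hb
    · rintro _ ⟨a, ha, rfl⟩
      have h2 := hp a ha 0 (by simp)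
      rw [h0, sub_zero, abs_of_nonneg ha.1] at h2
      have h3 := mul_le_mul_of_nonneg_right ha.2 (dist_nonneg (x := fold y) (y := fold z))
      rw [mem_ball]
      have := dist_triangle (p a) y x
      rw [dist_comm y x] at this
      linarith [dist_le_of_isString hs]

instance : PathConnectedSpace (Davis Γ) where
  nonempty := ⟨Davis.mk 1 Chamber.zero⟩
  joined x y := (joinedIn_ball (lt_add_one (dist x y))).joined

theorem isPathConnected_subcomplex (u : W Γ) (H : Set V) : IsPathConnected (subcomplex u H) := by
  have := isPathConnected_univ.image (continuous_retract (Γ := Γ) u H)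
  convert this using 1
  refine Subset.antisymm (fun x hx => ⟨x, trivial, retract_eq_self hx⟩) ?_
  rintro _ ⟨x, -, rfl⟩
  exact retract_mem u H x

theorem isPathConnected_of_joinedIn {X : Type*} [TopologicalSpace X] {S D : Set X}
    (hD : IsPathConnected D) (hDS : D ⊆ S) (h : ∀ x ∈ S, ∃ y ∈ D, JoinedIn S x y) :
    IsPathConnected S := by
  obtain ⟨z, hz, hz'⟩ := hD
  refine ⟨z, hDS hz, fun {x} hx => ?_⟩
  obtain ⟨y, hy, hxy⟩ := h x hx
  exact ((hz' hy).mono hDS).trans hxy.symm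

/-- The neighbourhoods of a coset meet another coset that is not disjoint from it in path
connected sets: the retraction onto the second coset maps the first one to itself, so a path in a
ball around a point of the first coset can be pushed into the second one. -/
theorem isPathConnected_thickening_inter (u : W Γ) (H H' : Set V) {C : ℝ} (hC : 0 < C) :
    IsPathConnected (thickening C (subcomplex u H) ∩ subcomplex u H') := by
  refine isPathConnected_of_joinedIn (isPathConnected_subcomplex u (H ∩ H'))
    (fun x hx => ⟨self_subset_thickening hC _ (subcomplex_mono u inter_subset_left hx),
      subcomplex_mono u inter_subset_right hx⟩) ?_
  rintro x ⟨hx, hx'⟩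
  obtain ⟨a, ha, hxa⟩ := mem_thickening_iff.1 hx
  have hmem := retract_mem_inter u H' ha
  refine ⟨_, hmem, ?_⟩
  have h1 := JoinedIn.map (joinedIn_ball (show dist a x < C by rwa [dist_comm])).symm
    (continuous_retract u H')
  rw [retract_eq_self hx'] at h1
  refine h1.mono ?_
  rintro _ ⟨z, hz, rfl⟩
  refine ⟨mem_thickening_iff.2 ⟨_, subcomplex_mono u inter_subset_left hmem, ?_⟩,
    retract_mem u H' z⟩
  exact (dist_retract_le u H' z a).trans_lt hz

end Metric

/-! ### Crossing a wall -/

section Walls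

variable {V : Type*} {Γ : SimpleGraph V}

open Classical in
/-- The value of `wallCoord` at a representative of a point. -/
def wallCoordRep (u : W Γ) (s : V) (p : W Γ × Chamber Γ) : ℝ :=
  ((side Γ s (u⁻¹ * p.1) : ℤ) : ℝ) * (1 / 2 - if u⁻¹ * p.1 ∈ star Γ s then p.2.coord s else 0)

theorem abs_wallCoordRep_sub_le (u : W Γ) (s : V) {b : W Γ} {T : Set V} (hT : Γ.IsClique T)
    {p q : W Γ × Chamber Γ} (hp : b⁻¹ * p.1 ∈ special Γ T) (hpT : p.2.support ⊆ T)
    (hq : b⁻¹ * q.1 ∈ special Γ T) (hqT : q.2.support ⊆ T) :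
    |wallCoordRep u s p - wallCoordRep u s q| ≤
        |fold (Davis.mk p.1 p.2) s - fold (Davis.mk q.1 q.2) s| ∧
      (wallCoordRep u s p ≠ wallCoordRep u s q → s ∈ T ∧ u⁻¹ * p.1 ∈ star Γ s) := by
  obtain ⟨g, t⟩ := p
  obtain ⟨w, t'⟩ := q
  dsimp only at *
  have hgw : g⁻¹ * w ∈ special Γ T := by simpa [mul_assoc] using mul_mem (inv_mem hp) hq
  have huw : u⁻¹ * w = u⁻¹ * g * (g⁻¹ * w) := by group
  by_cases hs : s ∈ T
  · have hstar : g⁻¹ * w ∈ star Γ s := special_mono Γ (fun r hr => by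
      by_cases h : r = s
      · exact Or.inl h
      · exact Or.inr (hT hs hr (Ne.symm h))) hgw
    have hiff : u⁻¹ * w ∈ star Γ s ↔ u⁻¹ * g ∈ star Γ s := by
      rw [huw, Subgroup.mul_mem_cancel_right _ hstar]
    by_cases hg : u⁻¹ * g ∈ star Γ s
    · refine ⟨?_, fun _ => ⟨hs, hg⟩⟩
      have hw := hiff.2 hg
      simp only [wallCoordRep, if_pos hg, if_pos hw, side_eq_sign Γ hg, side_eq_sign Γ hw, fold_mk,
        map_mul, Units.val_mul, Int.cast_mul, mul_assoc]
      rw [← mul_sub, abs_mul, abs_sign, one_mul]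
    · have : wallCoordRep u s (g, t) = wallCoordRep u s (w, t') := by
        simp only [wallCoordRep, if_neg hg, if_neg (hiff.not.2 hg)]
        rw [huw, side_mul_of_notMem_star Γ hg hstar]
      rw [this, sub_self, abs_zero]
      exact ⟨abs_nonneg _, fun h => absurd rfl h⟩
  · have h0 : ∀ t : Chamber Γ, t.support ⊆ T → t.coord s = 0 := by
      intro t ht
      by_contra h
      exact hs (ht h)
    have : wallCoordRep u s (g, t) = wallCoordRep u s (w, t') := by
      simp only [wallCoordRep, h0 t hpT, h0 t' hqT, ite_self]
      rw [huw, side_mul_of_notMem Γ hs _ hgw]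
    rw [this, sub_self, abs_zero]
    exact ⟨abs_nonneg _, fun h => absurd rfl h⟩

/-- The signed distance to the wall dual to the edge from `u` to `u s`, cut off at the boundary of
the union of the cubes that the wall crosses. It is positive on the side of `u`. -/
def wallCoord (u : W Γ) (s : V) (x : Davis Γ) : ℝ :=
  Quotient.lift (s := davisSetoid Γ) (wallCoordRep u s) (by
    rintro ⟨g, t⟩ ⟨h, t'⟩ hr
    have heq : Davis.mk g t = Davis.mk h t' := Quotient.sound hr
    obtain ⟨h0, h1⟩ := hr
    dsimp only at h0 h1
    subst h0
    have := (abs_wallCoordRep_sub_le u s t.isClique (b := g) (p := (g, t)) (q := (h, t))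
      (by simp [one_mem]) subset_rfl (special_mono Γ t.mirrors_subset_support h1) subset_rfl).1
    rw [heq, sub_self, abs_zero] at this
    exact sub_eq_zero.1 (abs_nonpos_iff.1 this)) x

open Classical in
theorem wallCoord_mk (u : W Γ) (s : V) (g : W Γ) (t : Chamber Γ) :
    wallCoord u s (Davis.mk g t) = ((side Γ s (u⁻¹ * g) : ℤ) : ℝ) *
      (1 / 2 - if u⁻¹ * g ∈ star Γ s then t.coord s else 0) := rfl

theorem wallCoord_of_mem (u : W Γ) {s : V} {H : Set V} (hs : s ∉ H) {x : Davis Γ}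
    {g : W Γ} (hx : x ∈ subcomplex g H) :
    wallCoord u s x = ((side Γ s (u⁻¹ * g) : ℤ) : ℝ) * (1 / 2) := by
  obtain ⟨w, t, hw, ht, rfl⟩ := hx
  have h0 : t.coord s = 0 := by
    by_contra h
    exact hs (ht h)
  rw [wallCoord_mk, h0, ite_self, sub_zero, show u⁻¹ * w = u⁻¹ * g * (g⁻¹ * w) by group,
    side_mul_of_notMem Γ hs _ hw]

theorem wallCoord_of_mem_subcomplex (u : W Γ) {s : V} {H : Set V} (hs : s ∉ H) {x : Davis Γ}
    (hx : x ∈ subcomplex u H) : wallCoord u s x = 1 / 2 := by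
  rw [wallCoord_of_mem u hs hx]
  simp

theorem wallCoord_of_mem_subcomplex_mul_gen (u : W Γ) {s : V} {H : Set V} (hs : s ∉ H)
    {x : Davis Γ} (hx : x ∈ subcomplex (u * gen Γ s) H) : wallCoord u s x = -(1 / 2) := by
  have := side_gen_mul Γ s 1
  rw [mul_one, side_one] at this
  rw [wallCoord_of_mem u hs hx, inv_mul_cancel_left, this]
  simp

theorem SameCube.exists_of_wallCoord_ne {u : W Γ} {s : V} {y z : Davis Γ} (h : SameCube y z)
    (hne : wallCoord u s y ≠ wallCoord u s z) :
    ∃ g t, u⁻¹ * g ∈ star Γ s ∧ t.support ⊆ insert s (Γ.neighborSet s) ∧ y = Davis.mk g t := by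
  obtain ⟨b, T, hT, ⟨g, t, hg, ht, rfl⟩, ⟨w, t', hw, ht', rfl⟩⟩ := h
  obtain ⟨hs, hst⟩ :=
    (abs_wallCoordRep_sub_le u s hT (p := (g, t)) (q := (w, t')) hg ht hw ht').2 hne
  refine ⟨g, t, hst, fun r hr => ?_, rfl⟩
  by_cases h : r = s
  · exact Or.inl h
  · exact Or.inr (hT hs (ht hr) (Ne.symm h))

variable [Fintype V]

theorem abs_wallCoord_sub_le (u : W Γ) (s : V) (x y : Davis Γ) :
    |wallCoord u s x - wallCoord u s y| ≤ dist x y := by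
  have key : ∀ {l : ℝ}, IsString x y l → |wallCoord u s x - wallCoord u s y| ≤ l := by
    intro l h
    induction h with
    | refl => simp
    | @step y z l _ hc ih =>
      refine (abs_sub_le _ (wallCoord u s y) _).trans (add_le_add ih ?_)
      refine le_trans ?_ (abs_fold_sub_le y z s)
      obtain ⟨b, T, hT, ⟨g, t, hg, ht, rfl⟩, ⟨w, t', hw, ht', rfl⟩⟩ := hc
      exact (abs_wallCoordRep_sub_le u s hT (p := (g, t)) (q := (w, t')) hg ht hw ht').1
  refine le_of_forall_gt fun r hr => ?_
  obtain ⟨l, hl, h⟩ := exists_isString_of_dist_lt hr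
  exact (key h).trans_lt hl

/-- A string that starts on the negative side of the union of the cubes that a wall crosses, and
leaves this side, has to pass through one of these cubes. -/
theorem IsString.exists_crossing {u : W Γ} {s : V} {x y : Davis Γ} {l : ℝ} (h : IsString x y l)
    (hx : wallCoord u s x = -(1 / 2)) (hy : wallCoord u s y ≠ -(1 / 2)) :
    ∃ g t, u⁻¹ * g ∈ star Γ s ∧ t.support ⊆ insert s (Γ.neighborSet s) ∧
      wallCoord u s (Davis.mk g t) = -(1 / 2) ∧
      dist x (Davis.mk g t) + dist (Davis.mk g t) y ≤ l := by
  induction h with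
  | refl => exact absurd hx hy
  | @step y z l hs hc ih =>
    by_cases hy' : wallCoord u s y = -(1 / 2)
    · obtain ⟨g, t, h1, h2, rfl⟩ := hc.exists_of_wallCoord_ne (hy'.trans_ne hy.symm)
      exact ⟨g, t, h1, h2, hy', add_le_add (dist_le_of_isString hs) hc.dist_le⟩
    · obtain ⟨g, t, h1, h2, h3, h4⟩ := ih hy'
      refine ⟨g, t, h1, h2, h3, ?_⟩
      have := dist_triangle (Davis.mk g t) y z
      have := hc.dist_le
      linarith

/-- The cosets `u W_H` and `u s W_H` are at distance one along the subcomplex of the common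
neighbours of `s` in `H`. -/
theorem exists_dist_le_one (u : W Γ) {s : V} {H : Set V} {x : Davis Γ}
    (hx : x ∈ subcomplex (u * gen Γ s) (H ∩ Γ.neighborSet s)) :
    ∃ y ∈ subcomplex u H, dist x y ≤ 1 := by
  obtain ⟨w, t, hw, ht, rfl⟩ := hx
  have hstar : (u * gen Γ s)⁻¹ * w ∈ star Γ s :=
    special_mono Γ (fun r hr => Or.inr hr.2) hw
  have hts : s ∉ t.support := fun h => Γ.irrefl (ht h).2
  have ht0 : t.coord s = 0 := by
    by_contra h
    exact hts h
  refine ⟨Davis.mk (w * gen Γ s) t, mk_mem_subcomplex ?_ (ht.trans inter_subset_left), ?_⟩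
  · have h1 := commute_of_mem_star Γ hstar
    have h2 : u⁻¹ * (w * gen Γ s) = (u * gen Γ s)⁻¹ * w := by
      calc u⁻¹ * (w * gen Γ s) = gen Γ s * (((u * gen Γ s)⁻¹ * w) * gen Γ s) := by group
        _ = _ := by rw [← h1, ← mul_assoc, gen_mul_gen, one_mul]
    rw [h2]
    exact special_mono Γ inter_subset_left hw
  · have hc : SameCube (Davis.mk w t) (Davis.mk (w * gen Γ s) t) := by
      refine ⟨w, insert s t.support, ?_, mk_mem_subcomplex (by simp [one_mem]) (subset_insert _ _),
        mk_mem_subcomplex (by simpa using gen_mem Γ (mem_insert _ _)) (subset_insert _ _)⟩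
      exact SimpleGraph.IsClique.insert t.isClique fun r hr _ => (ht hr).2
    refine hc.dist_le.trans ?_
    rw [EuclideanSpace.dist_eq, Finset.sum_eq_single s]
    · rw [Real.sqrt_sq dist_nonneg, Real.dist_eq, fold_mk, fold_mk, map_mul, sign_gen, if_pos rfl,
        ht0]
      rcases Int.units_eq_one_or (sign Γ s w) with h | h <;> rw [h] <;> norm_num
    · intro r _ hr
      rw [fold_mk, fold_mk, map_mul, sign_gen, if_neg (Ne.symm hr), mul_one, dist_self]
      norm_num
    · simp

/-- The neighbourhoods of a coset `u W_H` meet the parallel coset `u s W_H` in path connected sets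
if they are so large that this intersection contains the part of the second coset at distance one:
a path from a point of the second coset to the first one has to pass through a cube that the wall
between the two cosets crosses, and up to this cube it can be pushed into the second coset. -/
theorem isPathConnected_thickening_inter_mul_gen (u : W Γ) {s : V} {H : Set V} (hs : s ∉ H)
    {C : ℝ} (hC : 1 < C) :
    IsPathConnected (thickening C (subcomplex u H) ∩ subcomplex (u * gen Γ s) H) := by
  refine isPathConnected_of_joinedIn
    (isPathConnected_subcomplex (u * gen Γ s) (H ∩ Γ.neighborSet s)) (fun x hx => ?_) ?_
  · obtain ⟨y, hy, hxy⟩ := exists_dist_le_one u hx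
    exact ⟨mem_thickening_iff.2 ⟨y, hy, hxy.trans_lt hC⟩, subcomplex_mono _ inter_subset_left hx⟩
  rintro x ⟨hx, hx'⟩
  obtain ⟨a, ha, hxa⟩ := mem_thickening_iff.1 hx
  obtain ⟨l, hl, hstr⟩ := exists_isString_of_dist_lt hxa
  have hwa := wallCoord_of_mem_subcomplex u hs ha
  obtain ⟨g, t, hg, ht, hz, hzl⟩ := hstr.exists_crossing
    (wallCoord_of_mem_subcomplex_mul_gen u hs hx') (by rw [hwa]; norm_num)
  -- The remaining part of the string has to cross the cubes of the wall.
  have hza := abs_wallCoord_sub_le u s (Davis.mk g t) a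
  rw [hz, hwa, abs_of_neg (by norm_num)] at hza
  have hmem : retract (u * gen Γ s) H (Davis.mk g t) ∈
      subcomplex (u * gen Γ s) (H ∩ Γ.neighborSet s) := by
    have h1 : Davis.mk g t ∈ subcomplex (u * gen Γ s) (insert s (Γ.neighborSet s)) := by
      refine mk_mem_subcomplex ?_ ht
      rw [mul_inv_rev, gen_inv, mul_assoc]
      exact mul_mem (gen_mem_star Γ s) hg
    refine subcomplex_mono _ ?_ (retract_mem_inter (u * gen Γ s) H h1)
    rintro r ⟨rfl | hr, hr'⟩
    · exact absurd hr' hs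
    · exact ⟨hr', hr⟩
  refine ⟨_, hmem, ?_⟩
  obtain ⟨a', ha', hza'⟩ := exists_dist_le_one u hmem
  have h1 := JoinedIn.map (joinedIn_ball (r := C - 1)
    (show dist (Davis.mk g t) x < C - 1 by rw [dist_comm]; linarith)).symm
    (continuous_retract (u * gen Γ s) H)
  rw [retract_eq_self hx'] at h1
  refine h1.mono ?_
  rintro _ ⟨z, hz, rfl⟩
  refine ⟨mem_thickening_iff.2 ⟨a', ha', ?_⟩, retract_mem _ H z⟩
  have h2 := dist_triangle (retract (u * gen Γ s) H z) (retract (u * gen Γ s) H (Davis.mk g t)) a'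
  have h3 := (dist_retract_le (u * gen Γ s) H z (Davis.mk g t)).trans_lt hz
  linarith

end Walls

/-! ### Comparison with the group -/

section Proper

variable {V : Type*} {Γ : SimpleGraph V}

open scoped Pointwise

variable (Γ) in
/-- The elements of the special subgroups of cliques. -/
def cliqueElements : Set (W Γ) := {w | ∃ T, Γ.IsClique T ∧ w ∈ special Γ T}

theorem finite_cliqueElements [Finite V] : (cliqueElements Γ).Finite := by
  have : cliqueElements Γ = ⋃ T ∈ {T | Γ.IsClique T}, (special Γ T : Set (W Γ)) := by
    ext w; simp [cliqueElements]
  rw [this]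
  exact (toFinite _).biUnion fun T hT => finite_special Γ hT

theorem inv_mul_mem_cliqueElements_of_eq {g h : W Γ} {t t' : Chamber Γ}
    (heq : Davis.mk g t = Davis.mk h t') : g⁻¹ * h ∈ cliqueElements Γ :=
  ⟨_, SimpleGraph.IsClique.subset t.mirrors_subset_support t.isClique, (Davis.mk_eq_iff.1 heq).2⟩

theorem finite_cliqueElements_pow [Finite V] (n : ℕ) : (cliqueElements Γ ^ n).Finite := by
  induction n with
  | zero => simp
  | succ n ih => rw [pow_succ]; exact ih.mul finite_cliqueElements

theorem setOf_lt_isClique (t : Chamber Γ) : Γ.IsClique {s | 1 / 4 < t.coord s} :=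
  SimpleGraph.IsClique.subset (s := {s | t.coord s ≠ 0})
    (fun _ hs => ((by norm_num : (0 : ℝ) < 1 / 4).trans hs).ne') t.isClique

variable [Fintype V]

/-- A short string starting in the copy of the chamber at `g` stays in the copies at `g w`, where
the letters of `w` are those that belong to midcubes near the starting point. -/
theorem IsString.mem_special_of_lt {x y : Davis Γ} {l : ℝ} (h : IsString x y l) (hl : l < 1 / 4)
    {g g' : W Γ} {t t' : Chamber Γ} (hx : x = Davis.mk g t) (hy : y = Davis.mk g' t') :
    g⁻¹ * g' ∈ special Γ {s | 1 / 4 < t.coord s} := by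
  induction h generalizing g' t' with
  | refl =>
    obtain ⟨rfl, h⟩ := Davis.mk_eq_iff.1 (hx.symm.trans hy)
    refine special_mono Γ (fun s hs => ?_) h
    change _ < t.coord s
    rw [show t.coord s = 1 / 2 from hs]
    norm_num
  | @step y z l hs hc ih =>
    have hfold : ∀ s, |fold x s - fold z s| < 1 / 4 := fun s =>
      ((abs_fold_sub_le _ _ s).trans (hs.step hc).dist_fold_le).trans_lt hl
    obtain ⟨b, T, hT, ⟨w, t₁, hw, -, rfl⟩, ⟨w', t₂, hw', -, rfl⟩⟩ := hc
    have h1 := ih ((le_add_of_nonneg_right dist_nonneg).trans_lt hl) rfl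
    obtain ⟨rfl, h3⟩ := Davis.mk_eq_iff.1 hy
    subst hx
    have hww : w⁻¹ * w' ∈ special Γ T := by
      simpa [mul_assoc] using mul_mem (inv_mem hw) hw'
    have h2 : w⁻¹ * w' ∈ special Γ {s | 1 / 4 < t.coord s} := by
      refine mem_special_of_sign Γ hT hww fun s _ hs'' => ?_
      have hs' : t.coord s ≤ 1 / 4 := not_lt.1 hs''
      have h4 := sign_eq_one Γ hs'' h1
      rw [map_mul, map_inv, inv_mul_eq_one] at h4 ⊢
      rw [← h4]
      by_contra hne
      have h5 := hfold s
      have h6 := t₂.le_half s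
      have h7 := abs_lt.1 h5
      rw [fold_mk, fold_mk] at h7
      rcases Int.units_eq_one_or (sign Γ s g) with h8 | h8 <;>
        rcases Int.units_eq_one_or (sign Γ s w') with h9 | h9 <;> rw [h8, h9] at h7 hne <;>
        norm_num at h7 hne <;> linarith
    have h3' : w'⁻¹ * g' ∈ special Γ {s | 1 / 4 < t.coord s} := by
      refine special_mono Γ (fun s hs' => ?_) h3
      have h5 := hfold s
      have h6 := abs_fold_mk g t s
      rw [fold_mk w', show t₂.coord s = 1 / 2 from hs', sub_self, mul_zero, sub_zero, h6] at h5
      change 1 / 4 < t.coord s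
      linarith
    have := mul_mem (mul_mem h1 h2) h3'
    convert this using 1
    group

/-- A string is cut into short pieces and steps inside a cube; the number of these pieces is
bounded in terms of the length of the string. -/
theorem IsString.exists_pow {x y : Davis Γ} {l : ℝ} (h : IsString x y l) {g : W Γ} {t : Chamber Γ}
    (hx : x = Davis.mk g t) : ∃ (N : ℕ) (z : Davis Γ) (m : ℝ), IsString z y m ∧ m < 1 / 4 ∧
      N / 12 + m ≤ l ∧ ∀ h u, z = Davis.mk h u → g⁻¹ * h ∈ cliqueElements Γ ^ (N + 1) := by
  induction h with
  | refl =>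
    refine ⟨0, x, 0, .refl x, by norm_num, by simp, fun h u hz => ?_⟩
    simpa using inv_mul_mem_cliqueElements_of_eq (hx.symm.trans hz)
  | @step y y' l _ hc ih =>
    obtain ⟨N, z, m, hzy, hm, hl, hz⟩ := ih
    by_cases hlt : m + dist (fold y) (fold y') < 1 / 4
    · exact ⟨N, z, _, hzy.step hc, hlt, by linarith, hz⟩
    · refine ⟨N + 3, y', 0, .refl _, by norm_num, by push_cast; linarith, fun h' u' hy' => ?_⟩
      obtain ⟨b, T, hT, ⟨w, t₁, hw, -, rfl⟩, ⟨w', t₂, hw', -, rfl⟩⟩ := hc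
      obtain ⟨h, u, rfl⟩ := z.exists_rep
      have h1 := hz h u rfl
      have h2 : h⁻¹ * w ∈ cliqueElements Γ :=
        ⟨_, setOf_lt_isClique u, hzy.mem_special_of_lt hm rfl rfl⟩
      have h3 : w⁻¹ * w' ∈ cliqueElements Γ :=
        ⟨T, hT, by simpa [mul_assoc] using mul_mem (inv_mem hw) hw'⟩
      have h4 := inv_mul_mem_cliqueElements_of_eq hy'
      have := mul_mem_mul (mul_mem_mul (mul_mem_mul h1 h2) h3) h4
      rw [← pow_succ, ← pow_succ, ← pow_succ] at this
      convert this using 1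
      group

/-- Copies of the chamber at a bounded distance differ by elements of a finite set. -/
theorem exists_finite_of_dist_lt (Γ : SimpleGraph V) (R : ℝ) : ∃ Q : Set (W Γ), Q.Finite ∧
    ∀ g t g' t', dist (Davis.mk g t) (Davis.mk g' t') < R → g⁻¹ * g' ∈ Q := by
  refine ⟨⋃ N ∈ Iic ⌊12 * R⌋₊, cliqueElements Γ ^ (N + 2),
    (finite_Iic _).biUnion fun N _ => finite_cliqueElements_pow _, fun g t g' t' h => ?_⟩
  obtain ⟨l, hl, hs⟩ := exists_isString_of_dist_lt h
  obtain ⟨N, z, m, hzy, hm, hNl, hz⟩ := hs.exists_pow rfl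
  obtain ⟨w, u, rfl⟩ := z.exists_rep
  refine mem_biUnion (x := N) (Nat.le_floor (by linarith [hzy.nonneg])) ?_
  have h2 : w⁻¹ * g' ∈ cliqueElements Γ :=
    ⟨_, setOf_lt_isClique u, hzy.mem_special_of_lt hm rfl rfl⟩
  have := mul_mem_mul (hz w u rfl) h2
  rw [← pow_succ] at this
  convert this using 1
  group

theorem ediam_eq_top_of_subset {S : Set (Davis Γ)} {g : W Γ} {H : Set V} {a b : V} (ha : a ∈ H)
    (hb : b ∈ H) (hab : a ≠ b) (hadj : ¬ Γ.Adj a b) (h : subcomplex g H ⊆ S) :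
    ediam S = ⊤ := by
  by_contra hS
  obtain ⟨R, hR⟩ := isBounded_iff.1 (isBounded_iff_ediam_ne_top.2 hS)
  obtain ⟨Q, hQ, hQ'⟩ := exists_finite_of_dist_lt Γ (R + 1)
  refine infinite_range_of_injective (injective_pow Γ hadj hab) (hQ.subset ?_)
  rintro _ ⟨n, rfl⟩
  have hn : (gen Γ a * gen Γ b) ^ n ∈ special Γ H :=
    pow_mem (mul_mem (gen_mem Γ ha) (gen_mem Γ hb)) n
  have := hQ' g Chamber.zero (g * (gen Γ a * gen Γ b) ^ n) Chamber.zero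
    ((hR (h (mk_zero_mem_subcomplex (by simp [one_mem])))
      (h (mk_zero_mem_subcomplex (by simpa using hn)))).trans_lt (lt_add_one R))
  simpa using this

end Proper

/-! ### The sequence of realizations -/

section Upper

variable {V : Type*} {Γ : SimpleGraph V}

/-- The pieces of `g W_F`, where `F` is the union of the equivalence class of `H₀`: the cosets in
`g W_F` of the special subgroups of the hyperedges in this class that are not strips. -/
def pieces (E : Set (Set V)) (H₀ : Set V) (g : W Γ) : Set (Set (Davis Γ)) :=
  {B | ∃ K ∈ E \ stripSubgraphs Γ, HyperedgeEquiv Γ E H₀ K ∧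
    ∃ u, g⁻¹ * u ∈ special Γ (classUnion Γ E H₀) ∧ B = subcomplex u K}

variable {E : Set (Set V)} {H₀ : Set V} {g : W Γ}

theorem biUnion_pieces_subset : ⋃ B ∈ pieces E H₀ g, B ⊆ subcomplex g (classUnion Γ E H₀) := by
  refine iUnion₂_subset ?_
  rintro _ ⟨K, hK, hK₀, u, hu, rfl⟩
  exact (subcomplex_mono u (subset_classUnion hK.1 hK₀)).trans (subcomplex_subset hu)

variable [Fintype V]

theorem exists_sequence_of_reflTransGen {α : Type*} {r : α → α → Prop} {a b : α}
    (h : Relation.ReflTransGen r a b) :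
    ∃ (m : ℕ) (S : ℕ → α), S 0 = a ∧ S m = b ∧ ∀ j < m, r (S j) (S (j + 1)) := by
  induction h with
  | refl => exact ⟨0, fun _ => a, rfl, rfl, by simp⟩
  | @tail b c _ hbc ih =>
    obtain ⟨m, S, h0, hm, hS⟩ := ih
    refine ⟨m + 1, fun j => if j ≤ m then S j else c, by simpa using h0, by simp, fun j hj => ?_⟩
    rcases (Nat.lt_succ_iff.1 hj).lt_or_eq with hj | rfl
    · simpa [hj.le, Nat.succ_le_of_lt hj] using hS j hj
    · simpa [hm] using hbc

/-- A constant for which the realizations form a coarse intersection sequence: it exceeds the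
diameters of the cubes, and the distance one of parallel cosets on the two sides of a wall. -/
def chainConstant (V : Type*) [Fintype V] : ℝ := √(Fintype.card V) + 2

theorem sqrt_card_lt_chainConstant (V : Type*) [Fintype V] :
    √(Fintype.card V) < chainConstant V := by
  rw [chainConstant]; linarith

theorem one_lt_chainConstant (V : Type*) [Fintype V] : 1 < chainConstant V := by
  have := Real.sqrt_nonneg (Fintype.card V)
  rw [chainConstant]; linarith

theorem chainConstant_pos (V : Type*) [Fintype V] : 0 < chainConstant V :=
  one_pos.trans (one_lt_chainConstant V)

/-- The relation of consecutive members of a chain of pieces. -/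
def Consecutive (P : Set (Set (Davis Γ))) (A B : Set (Davis Γ)) : Prop :=
  A ∈ P ∧ B ∈ P ∧ ediam (thickening (chainConstant V) A ∩ B) = ⊤ ∧
    IsPathConnected (thickening (chainConstant V) A ∩ B)

theorem consecutive_subcomplex {P : Set (Set (Davis Γ))} {u : W Γ} {H H' : Set V}
    (hH : subcomplex u H ∈ P) (hH' : subcomplex u H' ∈ P) (h : HasNonadjacentPair Γ (H ∩ H')) :
    Consecutive P (subcomplex u H) (subcomplex u H') := by
  obtain ⟨a, ha, b, hb, hab, hadj⟩ := h
  refine ⟨hH, hH', ediam_eq_top_of_subset ha hb hab hadj (g := u) ?_,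
    isPathConnected_thickening_inter u H H' (chainConstant_pos V)⟩
  exact subset_inter ((subcomplex_mono u inter_subset_left).trans
    (self_subset_thickening (chainConstant_pos V) _)) (subcomplex_mono u inter_subset_right)

theorem consecutive_subcomplex_mul_gen {P : Set (Set (Davis Γ))} {u : W Γ} {s : V} {H : Set V}
    (hs : s ∉ H) (hH : subcomplex u H ∈ P) (hH' : subcomplex (u * gen Γ s) H ∈ P)
    (h : HasNonadjacentPair Γ (H ∩ Γ.neighborSet s)) :
    Consecutive P (subcomplex u H) (subcomplex (u * gen Γ s) H) := by
  obtain ⟨a, ha, b, hb, hab, hadj⟩ := h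
  refine ⟨hH, hH', ediam_eq_top_of_subset ha hb hab hadj (g := u * gen Γ s) fun x hx => ?_,
    isPathConnected_thickening_inter_mul_gen u hs (one_lt_chainConstant V)⟩
  obtain ⟨y, hy, hxy⟩ := exists_dist_le_one u hx
  exact ⟨mem_thickening_iff.2 ⟨y, hy, hxy.trans_lt (one_lt_chainConstant V)⟩,
    subcomplex_mono _ inter_subset_left hx⟩

theorem reflTransGen_of_hyperedgeEquiv {u : W Γ} (hu : g⁻¹ * u ∈ special Γ (classUnion Γ E H₀))
    {K K' : Set V} (hK : K ∈ E \ stripSubgraphs Γ) (hK₀ : HyperedgeEquiv Γ E H₀ K)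
    (h : HyperedgeEquiv Γ (E \ stripSubgraphs Γ) K K') :
    Relation.ReflTransGen (Consecutive (pieces E H₀ g)) (subcomplex u K) (subcomplex u K') := by
  induction h with
  | refl => exact .refl
  | @tail K₁ K₂ h1 h2 ih =>
    have h3 : ∀ {L : Set V}, HyperedgeEquiv Γ (E \ stripSubgraphs Γ) K L →
        subcomplex u L ∈ pieces E H₀ g := fun {L} h =>
      ⟨L, h.mem hK, hK₀.trans (h.mono sdiff_subset), u, hu, rfl⟩
    exact ih.tail (consecutive_subcomplex (h3 h1) (h3 (h1.tail h2)) h2.2.2)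

/-- A generator in a hyperedge of the class that is not a strip is absorbed by this hyperedge. The
other generators of the clique of a strip commute with a pair of non-adjacent vertices of another
hyperedge of the class. -/
theorem reflTransGen_mul (hH₀ : H₀ ∈ E) (hH₀' : H₀ ∉ stripSubgraphs Γ) {u k : W Γ}
    (hu : g⁻¹ * u ∈ special Γ (classUnion Γ E H₀)) (hk : k ∈ special Γ (classUnion Γ E H₀)) :
    Relation.ReflTransGen (Consecutive (pieces E H₀ g)) (subcomplex u H₀)
      (subcomplex (u * k) H₀) := by
  have key : k ∈ special Γ (classUnion Γ E H₀) ∧ Relation.ReflTransGen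
      (Consecutive (pieces E H₀ g)) (subcomplex u H₀) (subcomplex (u * k) H₀) := by
    refine special_induction Γ (p := fun k => k ∈ special Γ (classUnion Γ E H₀) ∧
      Relation.ReflTransGen (Consecutive (pieces E H₀ g)) (subcomplex u H₀)
        (subcomplex (u * k) H₀)) ⟨one_mem _, by rw [mul_one]⟩ ?_ hk
    rintro k r hr ⟨hk, ih⟩
    have hkr := mul_mem hk (gen_mem Γ hr)
    refine ⟨hkr, ih.trans ?_⟩
    have hv : g⁻¹ * (u * k) ∈ special Γ (classUnion Γ E H₀) := by
      rw [← mul_assoc]; exact mul_mem hu hk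
    have hv' : g⁻¹ * (u * k * gen Γ r) ∈ special Γ (classUnion Γ E H₀) := by
      simpa [mul_assoc] using mul_mem hu hkr
    rw [← mul_assoc]
    set v := u * k
    obtain ⟨H, ⟨-, hH⟩, hrH⟩ := hr
    obtain ⟨K, hK, hHK, hK', hpair⟩ := hH.exists_notMem_strip hH₀ hH₀'
    have hK₀ : HyperedgeEquiv Γ E H₀ K := hHK.mono sdiff_subset
    have h1 := reflTransGen_of_hyperedgeEquiv hv ⟨hH₀, hH₀'⟩ .refl hHK
    have h2 := reflTransGen_of_hyperedgeEquiv hv' hK hK₀ hHK.symm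
    refine h1.trans (Relation.ReflTransGen.trans ?_ h2)
    by_cases hrK : r ∈ K
    · rw [subcomplex_congr (g := v) (g' := v * gen Γ r) (by simpa using gen_mem Γ hrK)]
    · have hs : H ∈ stripSubgraphs Γ := by
        by_contra hs
        rw [hK' hs] at hrK
        exact hrK hrH
      obtain ⟨a, b, K', hab, hadj, -, -, rfl, hj⟩ := hs.1
      have ha : a ∈ K := hpair a (by simp) b (by simp) hab hadj
      have hb : b ∈ K := hpair b (by simp) a (by simp) hab.symm fun h => hadj h.symm
      have hrK' : r ∈ K' := by
        rcases hrH with (rfl | rfl) | h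
        · exact absurd ha hrK
        · exact absurd hb hrK
        · exact h
      exact .single (consecutive_subcomplex_mul_gen hrK ⟨K, hK, hK₀, v, hv, rfl⟩
        ⟨K, hK, hK₀, _, hv', rfl⟩
        ⟨a, ⟨ha, (hj a (by simp) r hrK').symm⟩, b, ⟨hb, (hj b (by simp) r hrK').symm⟩, hab, hadj⟩)
  exact key.2

theorem reflTransGen_pieces (hH₀ : H₀ ∈ E) (hH₀' : H₀ ∉ stripSubgraphs Γ)
    {A B : Set (Davis Γ)} (hA : A ∈ pieces E H₀ g) (hB : B ∈ pieces E H₀ g) :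
    Relation.ReflTransGen (Consecutive (pieces E H₀ g)) A B := by
  obtain ⟨K, hK, hK₀, u, hu, rfl⟩ := hA
  obtain ⟨K', hK', hK₀', u', hu', rfl⟩ := hB
  obtain ⟨L, hL, hHL, hLK, -⟩ := hK₀.exists_notMem_strip hH₀ hH₀'
  obtain rfl := hLK hK.2
  obtain ⟨L', hL', hHL', hLK', -⟩ := hK₀'.exists_notMem_strip hH₀ hH₀'
  obtain rfl := hLK' hK'.2
  have h := reflTransGen_mul hH₀ hH₀' hu (k := u⁻¹ * u')
    (by simpa [mul_assoc] using mul_mem (inv_mem hu) hu')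
  rw [mul_inv_cancel_left] at h
  exact (reflTransGen_of_hyperedgeEquiv hu hK hK₀ hHL.symm).trans
    (h.trans (reflTransGen_of_hyperedgeEquiv hu' ⟨hH₀, hH₀'⟩ .refl hHL'))

theorem subcomplex_subset_biUnion_pieces (hH₀ : H₀ ∈ E) (hH₀' : H₀ ∉ stripSubgraphs Γ) :
    subcomplex g (classUnion Γ E H₀) ⊆ ⋃ B ∈ pieces E H₀ g, thickening (chainConstant V) B := by
  rintro _ ⟨w, t, hw, -, rfl⟩
  refine mem_biUnion (x := subcomplex w H₀) ⟨H₀, ⟨hH₀, hH₀'⟩, .refl, w, hw, rfl⟩ ?_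
  exact mem_thickening_iff.2 ⟨_, mk_zero_mem_subcomplex (by simp [one_mem]),
    (dist_mk_zero_le w t).trans_lt (sqrt_card_lt_chainConstant V)⟩

theorem exists_isCoarseIntersectionSequence {i h : ℕ} (hih : i ≤ h)
    (hw : (wideSubgraphs Γ).Nonempty) (hh : univ ∈ lambdaHyperedges Γ h) :
    ∃ M C P, IsCoarseIntersectionSequence (realization Γ i) (h - i) M C P := by
  have key : ∀ (j : ℕ) (A : Set (Davis Γ)), ∃ P, A ∈ realization Γ (i + (j + 1)) →
      P ⊆ realization Γ (i + j) ∧ A ⊆ ⋃ B ∈ P, thickening (chainConstant V) B ∧ ⋃ B ∈ P, B ⊆ A ∧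
      ∀ B ∈ P, ∀ B' ∈ P, Relation.ReflTransGen (Consecutive P) B B' := by
    intro j A
    by_cases hA : A ∈ realization Γ (i + (j + 1))
    · obtain ⟨F, hF, hF', g, rfl⟩ := hA
      obtain ⟨H₀, hH₀, hH₀', rfl⟩ := exists_classUnion_eq (i := i + j) hF hF'
      refine ⟨pieces (lambdaHyperedges Γ (i + j)) H₀ g, fun _ => ⟨?_,
        subcomplex_subset_biUnion_pieces hH₀ hH₀', biUnion_pieces_subset,
        fun B hB B' hB' => reflTransGen_pieces hH₀ hH₀' hB hB'⟩⟩
      rintro _ ⟨K, hK, -, u, -, rfl⟩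
      exact ⟨K, hK.1, hK.2, u, rfl⟩
    · exact ⟨∅, fun h => absurd h hA⟩
  choose P hP using key
  refine ⟨fun j => realization Γ (i + j), chainConstant V, P, (chainConstant_pos V), rfl,
    fun j _ A hA => (hP j A hA).1, fun j _ A hA => (hP j A hA).2.1,
    fun j _ A hA => (hP j A hA).2.2.1, fun j _ B hB A hA A' hA' => ?_, ?_⟩
  · obtain ⟨m, S, h0, hm, hS⟩ :=
      exists_sequence_of_reflTransGen ((hP j B hB).2.2.2 A hA A' hA')
    refine ⟨m, S, h0, hm, fun k hk => ?_, fun k hk => (hS k hk).2.2⟩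
    cases k with
    | zero => rwa [h0]
    | succ k => exact (hS k hk).2.1
  · obtain ⟨L, hL⟩ := hw
    refine ⟨univ, ⟨univ, by rwa [Nat.add_sub_cancel' hih],
      hL.1.notMem_strip (subset_univ _), 1, (subcomplex_univ 1).symm⟩, fun B _ => ?_⟩
    exact (subset_univ B).trans (self_subset_thickening (chainConstant_pos V) _)

end Upper

/-! ### Coarse intersections of cosets -/

section Lower

variable {V : Type*} {Γ : SimpleGraph V}

/-- If `W_F` is coarsely dense in `W_Γ`, then every vertex outside `F` is adjacent to all the
others: the map to the infinite dihedral group that is defined by a pair of non-adjacent vertices,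
one of which is not in `F`, has finite image on `W_F`. -/
theorem adj_of_finite {F : Set V} {g : W Γ} {Q : Set (W Γ)} (hQ : Q.Finite)
    (h : ∀ w, ∃ u, g⁻¹ * u ∈ special Γ F ∧ w⁻¹ * u ∈ Q) {v : V} (hv : v ∉ F) (b : V) (hb : b ≠ v) :
    Γ.Adj v b := by
  by_contra hadj
  have hF : ∀ u ∈ special Γ F, dihedralHom Γ hadj u ∈ ({1, .sr 1} : Set (DihedralGroup 0)) := by
    intro u hu
    refine special_induction Γ
      (p := fun u => dihedralHom Γ hadj u ∈ ({1, .sr 1} : Set (DihedralGroup 0))) (by simp) ?_ hu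
    intro u r hr ih
    rw [map_mul, dihedralHom_gen, if_neg (by rintro rfl; exact hv hr)]
    split_ifs
    · rcases ih with h | h <;> rw [h] <;> simp
    · simpa using ih
  have hfin : (image2 (fun x q => dihedralHom Γ hadj g * x * (dihedralHom Γ hadj q)⁻¹)
      ({1, .sr 1} : Set (DihedralGroup 0)) Q).Finite := (toFinite _).image2 _ hQ
  have hinj : Function.Injective
      fun n : ℕ => dihedralHom Γ hadj ((gen Γ v * gen Γ b) ^ n) := by
    intro m n hmn
    simp only [dihedralHom_pow Γ hadj hb.symm] at hmn
    have h3 : ((m : ℤ)) = n := by simpa using hmn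
    exact_mod_cast h3
  refine infinite_range_of_injective hinj (hfin.subset ?_)
  rintro _ ⟨n, rfl⟩
  obtain ⟨u, hu, huQ⟩ := h ((gen Γ v * gen Γ b) ^ n)
  refine ⟨_, hF _ hu, _, huQ, ?_⟩
  dsimp only
  rw [← map_inv, ← map_mul, ← map_mul]
  congr 1
  group

variable [Fintype V]

theorem exists_mem_of_mem_thickening {R : ℝ} {Q : Set (W Γ)}
    (hQ : ∀ g t g' t', dist (Davis.mk g t) (Davis.mk g' t') < R → g⁻¹ * g' ∈ Q) {g w : W Γ}
    {t : Chamber Γ} {H : Set V} (h : Davis.mk w t ∈ thickening R (subcomplex g H)) :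
    ∃ u, g⁻¹ * u ∈ special Γ H ∧ w⁻¹ * u ∈ Q := by
  obtain ⟨_, ⟨u, t', hu, -, rfl⟩, hd⟩ := mem_thickening_iff.1 h
  exact ⟨u, hu, hQ _ _ _ _ hd⟩

/-- A set that meets the copies of the chamber at only finitely many elements is bounded. -/
theorem ediam_ne_top_of_finite {S : Set (Davis Γ)} {U : Set (W Γ)} (hU : U.Finite)
    (h : ∀ w t, Davis.mk w t ∈ S → w ∈ U) : ediam S ≠ ⊤ := by
  rw [← isBounded_iff_ediam_ne_top]
  have hb : Bornology.IsBounded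
      (⋃ w ∈ U, closedBall (Davis.mk w Chamber.zero : Davis Γ) √(Fintype.card V)) :=
    (Bornology.isBounded_biUnion hU).2 fun w _ => isBounded_closedBall
  refine hb.subset fun x hx => ?_
  obtain ⟨w, t, rfl⟩ := x.exists_rep
  exact mem_biUnion (h w t hx) (dist_mk_zero_le w t)

/-- If neighbourhoods of the subcomplexes of `g W_H` and `g' W_{H'}` have an unbounded set in
common, then `W_H` has infinite intersection with a conjugate of `W_{H'}`, the conjugating element
of which is `g⁻¹ g'` up to factors in the two subgroups. So `exists_nonadjacent_of_infinite`
applies. -/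
theorem exists_nonadjacent_of_ediam {S : Set (Davis Γ)} {R : ℝ} {g g' : W Γ} {H H' : Set V}
    (hS : ediam S = ⊤) (h : S ⊆ thickening R (subcomplex g H))
    (h' : S ⊆ thickening R (subcomplex g' H')) :
    ∃ a ∈ H ∩ H', ∃ b ∈ H ∩ H', a ≠ b ∧ ¬ Γ.Adj a b ∧ ∃ p ∈ special Γ H,
      ∃ q ∈ special Γ (Γ.neighborSet a ∩ Γ.neighborSet b), ∃ r ∈ special Γ H',
        g⁻¹ * g' = p * q * r := by
  obtain ⟨Q, hQ, hQR⟩ := exists_finite_of_dist_lt Γ R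
  let U : W Γ → Set (W Γ) := fun k => {u | g⁻¹ * u ∈ special Γ H ∧ g'⁻¹ * (u * k) ∈ special Γ H'}
  obtain ⟨k, hk⟩ : ∃ k, (U k).Infinite := by
    by_contra hU
    push Not at hU
    -- Otherwise, only finitely many copies of the chamber meet `S`.
    have hfin : (⋃ p ∈ Q ×ˢ Q, (fun u => u * p.1⁻¹) '' U (p.1⁻¹ * p.2)).Finite :=
      (hQ.prod hQ).biUnion fun p _ => (hU _).image _
    refine ediam_ne_top_of_finite hfin (fun w t hw => ?_) hS
    obtain ⟨u, hu, huQ⟩ := exists_mem_of_mem_thickening hQR (h hw)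
    obtain ⟨u', hu', huQ'⟩ := exists_mem_of_mem_thickening hQR (h' hw)
    refine mem_biUnion (x := (w⁻¹ * u, w⁻¹ * u')) ⟨huQ, huQ'⟩ ⟨u, ⟨hu, ?_⟩, by group⟩
    convert hu' using 1
    group
  obtain ⟨u₀, hu₀, hu₀'⟩ := hk.nonempty
  obtain ⟨a, ha, b, hb, hab, hadj, p, hp, q, hq, r, hr, hkr⟩ :=
    exists_nonadjacent_of_infinite Γ k H H' (by
      refine (hk.image (f := fun u => u₀⁻¹ * u) (mul_right_injective _).injOn).mono ?_
      rintro _ ⟨u, ⟨hu, hu'⟩, rfl⟩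
      constructor
      · simpa [mul_assoc] using mul_mem (inv_mem hu₀) hu
      · simpa [mul_assoc] using mul_mem (inv_mem hu₀') hu')
  refine ⟨a, ha, b, hb, hab, hadj, g⁻¹ * u₀ * p, mul_mem hu₀ hp, q, hq,
    r * (g'⁻¹ * (u₀ * k))⁻¹, mul_mem hr (inv_mem hu₀'), ?_⟩
  calc g⁻¹ * g' = g⁻¹ * u₀ * k * (g'⁻¹ * (u₀ * k))⁻¹ := by group
    _ = _ := by rw [← mul_assoc (_ * q), mul_assoc _ p, mul_assoc _ (p * q), ← hkr]

/-- In a coarse intersection sequence of a realization, the members of the `j`-th collection are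
uniformly close to subsets of cosets of special subgroups of hyperedges of index larger by `j`. -/
theorem exists_subset_thickening (hw : (wideSubgraphs Γ).Nonempty) {i n : ℕ}
    {M : ℕ → Set (Set (Davis Γ))} {C : ℝ} {P : ℕ → Set (Davis Γ) → Set (Set (Davis Γ))}
    (hM : IsCoarseIntersectionSequence (realization Γ i) n M C P) :
    ∀ j ≤ n, ∃ R : ℝ, ∀ A ∈ M j, ∃ g : W Γ, ∃ H ∈ lambdaHyperedges Γ (i + j),
      A ⊆ thickening R (subcomplex g H) := by
  intro j
  induction j with
  | zero =>
    refine fun _ => ⟨1, fun A hA => ?_⟩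
    rw [hM.zero] at hA
    obtain ⟨H, hH, -, g, rfl⟩ := hA
    exact ⟨g, H, hH, self_subset_thickening one_pos _⟩
  | succ j ih =>
    intro hj
    obtain ⟨R, hR⟩ := ih (by lia)
    choose! g H hH hA using hR
    refine ⟨C + R, fun B hB => ?_⟩
    have hB' := hM.subset_thickening j hj B hB
    have hP := hM.pieces_mem j hj B hB
    obtain hPe | ⟨A₀, hA₀⟩ := (P j B).eq_empty_or_nonempty
    · obtain ⟨K, hK, -⟩ := exists_notMem_strip hw (i + (j + 1))
      refine ⟨1, K, hK, hB'.trans ?_⟩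
      simp [hPe]
    have hH₀ := hH A₀ (hP hA₀)
    set E := lambdaHyperedges Γ (i + j)
    set F := classUnion Γ E (H A₀) with hF
    refine ⟨g A₀, F, classUnion_mem hH₀, hB'.trans (iUnion₂_subset fun A hAP => ?_)⟩
    have key : HyperedgeEquiv Γ E (H A₀) (H A) ∧ (g A₀)⁻¹ * g A ∈ special Γ F := by
      obtain ⟨m, S, h0, hm, hSP, hS⟩ := hM.chain j hj B hB A₀ hA₀ A hAP
      have hind : ∀ k ≤ m, HyperedgeEquiv Γ E (H A₀) (H (S k)) ∧
          (g A₀)⁻¹ * g (S k) ∈ special Γ F := by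
        intro k
        induction k with
        | zero =>
          intro _
          rw [h0, inv_mul_cancel]
          exact ⟨.refl, one_mem _⟩
        | succ k ihk =>
          intro hk
          obtain ⟨ih1, ih2⟩ := ihk (by lia)
          have hk1 := hP (hSP k (by lia))
          have hk2 := hP (hSP (k + 1) hk)
          obtain ⟨a, ha, b, hb, hab, hadj, p, hp, q, hq, r, hr, heq⟩ :=
            exists_nonadjacent_of_ediam (R := C + R) (hS k hk).1
              (inter_subset_left.trans ((thickening_subset_of_subset C (hA _ hk1)).trans
                (thickening_thickening_subset C R _)))
              (inter_subset_right.trans ((hA _ hk2).trans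
                (thickening_mono (by linarith [hM.pos]) _)))
          have hstep : HyperedgeEquiv Γ E (H A₀) (H (S (k + 1))) :=
            ih1.tail ⟨hH _ hk1, hH _ hk2, a, ha, b, hb, hab, hadj⟩
          refine ⟨hstep, ?_⟩
          have hq' : q ∈ special Γ F := by
            refine special_mono Γ (fun v hv => ?_) hq
            rw [hF, classUnion_congr ih1]
            exact mem_classUnion_of_adj (hH _ hk1) ha.1 hb.1 hab hadj hv.1 hv.2
          have hp' := special_mono Γ (subset_classUnion (hH _ hk1) ih1) hp
          have hr' := special_mono Γ (subset_classUnion (hH _ hk2) hstep) hr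
          have := mul_mem ih2 (mul_mem (mul_mem hp' hq') hr')
          rw [← heq] at this
          simpa [mul_assoc] using this
      rw [← hm]
      exact hind m le_rfl
    have h1 : A ⊆ thickening R (subcomplex (g A₀) F) := by
      rw [← subcomplex_congr key.2]
      exact (hA A (hP hAP)).trans (thickening_subset_of_subset R
        (subcomplex_mono _ (subset_classUnion (hH A (hP hAP)) key.1)))
    exact (thickening_subset_of_subset C h1).trans (thickening_thickening_subset C R _)

theorem univ_mem_lambdaHyperedges (hw : (wideSubgraphs Γ).Nonempty) {i n : ℕ}
    {M : ℕ → Set (Set (Davis Γ))} {C : ℝ} {P : ℕ → Set (Davis Γ) → Set (Set (Davis Γ))}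
    (hM : IsCoarseIntersectionSequence (realization Γ i) n M C P) :
    univ ∈ lambdaHyperedges Γ (i + n) := by
  obtain ⟨R, hR⟩ := exists_subset_thickening hw hM n le_rfl
  obtain ⟨A, hA, hAtop⟩ := hM.top
  obtain ⟨g, F, hF, hAF⟩ := hR A hA
  obtain ⟨Q, hQ, hQR⟩ := exists_finite_of_dist_lt Γ (C + R)
  obtain ⟨K, hK, hK'⟩ := exists_notMem_strip hw i
  have hdense : ∀ w : W Γ, ∃ u, g⁻¹ * u ∈ special Γ F ∧ w⁻¹ * u ∈ Q := by
    intro w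
    refine exists_mem_of_mem_thickening hQR (t := Chamber.zero) ?_
    exact thickening_thickening_subset C R _ (thickening_subset_of_subset C hAF
      (hAtop _ ⟨K, hK, hK', w, rfl⟩ (mk_zero_mem_subcomplex (by simp [one_mem]))))
  have : F = univ := by
    refine eq_univ_of_forall fun v => ?_
    by_contra hv
    exact hv (mem_of_forall_adj (adj_of_finite hQ hdense hv) hF)
  rwa [← this]

theorem hasCoarseIntersectionDegree_realization {h : ℕ} (hΓ : hypergraphIndex Γ = (h : ℕ∞))
    {i : ℕ} (hi : i ≤ h) : HasCoarseIntersectionDegree (realization Γ i) (h - i) := by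
  have hne : {m : ℕ∞ | ∃ n : ℕ, m = n ∧ (wideSubgraphs Γ).Nonempty ∧
      ∃ H ∈ lambdaHyperedges Γ n, H = Set.univ}.Nonempty := by
    by_contra hne
    rw [hypergraphIndex, not_nonempty_iff_eq_empty.1 hne, sInf_empty] at hΓ
    exact ENat.top_ne_natCast h hΓ
  obtain ⟨n, hn, hw, _, hH, rfl⟩ := csInf_mem hne
  obtain rfl : h = n := by
    have := hΓ.symm.trans hn
    exact_mod_cast this
  refine ⟨exists_isCoarseIntersectionSequence hi hw hH, ?_⟩
  rintro n ⟨M, C, P, hM⟩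
  have h1 : hypergraphIndex Γ ≤ ((i + n : ℕ) : ℕ∞) :=
    sInf_le ⟨i + n, rfl, hw, univ, univ_mem_lambdaHyperedges hw hM, rfl⟩
  rw [hΓ, Nat.cast_le] at h1
  lia

end Lower

end RACG

end

theorem mainTheorem7 {V : Type*} [Fintype V] (Γ : SimpleGraph V) (h : ℕ)
    (hΓ : RACG.hypergraphIndex Γ = (h : ℕ∞)) :
    HasCoarseIntersectionDegree (RACG.realization Γ 0) h ∧
      ∀ i ≤ h, HasCoarseIntersectionDegree (RACG.realization Γ i) (h - i) :=
  ⟨RACG.hasCoarseIntersectionDegree_realization hΓ (Nat.zero_le h),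
    fun _ hi => RACG.hasCoarseIntersectionDegree_realization hΓ hi⟩
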